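/- **Setting.** Let $d\ge 1$ and $T\ge 1$. Rewards follow a canonical exponential family with density $\exp(rx-b(x)+c(r))$ with respect to a reference measure $\nu$ on $\mathbb R$, normalized for every natural parameter $x\in\mathbb R$, with $b$ twice continuously differentiable; $\mu=\dot b$ is the mean function. In round $t=1,\dots,T$ the learner receives an action set $\mathcal A_t\subset\mathbb R^d$ and picks $a_t\in\mathcal A_t$ from the information $\mathcal F_t$ available so far; conditionally on $\mathcal F_t$ the reward $r_{t+1}$ has the law with natural parameter $a_t^\top\theta^\star_t$, and $r_{t+1}$ is part of the information $\mathcal F_{t+1}$. The deterministic parameters $\theta^\star_1,\dots,\theta^\star_T$ change at most $\Gamma_T$ times. The dynamic regret is $R_T=\sum_{t=1}^T\big(\max_{a\in\mathcal A_t}\mu(a^\top\theta_t^\star)-\mu(a_t^\top\theta^\star_t)\big)$. **Assumptions.** $\|\theta_t^\star\|_2\le S$ and $\|a\|_2\le 1$ for all $a\in\mathcal A_t$; $0\le r_{t+1}\le m$ almost surely, with $m>0$; $\mu$ is continuously differentiable and $k_\mu$-Lipschitz with $c_\mu=\inf_{\|\theta\|_2\le S,\|a\|_2\le1}\dot\mu(a^\top\theta)>0$;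 $\mu$ is twice differentiable with $|\ddot\mu|\le\dot\mu$. Every reward gap is at least $\Delta>0$: for all $t\le T$ and $a\in\mathcal A_t$ that is suboptimal for $\theta_t^\star$, $\max_{a'\in\mathcal A_t}\mu(a'^\top\theta_t^\star)-\mu(a^\top\theta_t^\star)\ge\Delta$. **Algorithm (D-GLUCB).** For $\lambda>0$, $\gamma\in(0,1)$, $\delta\in(0,1]$ let $\hat\theta_t$ minimize $-\sum_{s=1}^{t-1}\gamma^{t-1-s}\log\mathbb P_\theta(r_{s+1}|a_s)+\frac\lambda2\|\theta\|_2^2$ over $\theta\in\mathbb R^d$, let $V_t=\sum_{s=1}^{t-1}\gamma^{t-1-s}a_sa_s^\top+\frac{\lambda}{c_\mu}I_d$, and let $a_t$ maximize $\mu(a^\top\hat\theta_t)+\frac{\beta_T^\delta}{\sqrt{c_\mu}}\|a\|_{V_t^{-1}}$ over $a\in\mathcal A_t$, where $$\beta_T^\delta=k_\mu\sqrt\lambda\Big(1+\bar S+\sqrt{\tfrac{1+\bar S}{\lambda}}\,\rho_T^\delta+\big(\tfrac{\rho_T^\delta}{\sqrt\lambda}\big)^2\Big)^{3/2},\qquad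 \bar S=S+\frac{2Sk_\mu+m}{T\lambda(1-\gamma)},$$ $$\rho_T^\delta=\frac{\sqrt\lambda}{2m}+\frac{2m}{\sqrt\lambda}\log\frac T\delta+\frac{2m}{\sqrt\lambda}d\log 2+\frac{dm}{\sqrt\lambda}\log\Big(1+\frac{k_\mu(1-T^{-2})}{d\lambda(1-\gamma^2)}\Big).$$ **Theorem.** (1) There are positive constants $C_1,C_2,C_3,C_4$ depending only on $S,m,k_\mu,\lambda$ (in particular not on $c_\mu,\gamma,\Delta,\delta,d,T,\Gamma_T$) such that for all $\gamma\in(1/2,1)$, with probability at least $1-\delta$, $$R_T\le C_1\log(T)\frac{\Gamma_T}{1-\gamma}+\frac{C_2}{T(1-\gamma)^2\Delta}+C_3\frac{\beta_T^\delta\sqrt{dT}}{\sqrt{c_\mu}\,\Delta}\sqrt{T\log\tfrac1\gamma+\log\Big(1+\tfrac1{d\lambda(1-\gamma)}\Big)}+C_4\frac{d(\beta_T^\delta)^2}{c_\mu\Delta}\Big(T\log\tfrac1\gamma+\log\Big(1+\tfrac1{d\lambda(1-\gamma)}\Big)\Big).$$ (2) In particular, let $T\ge2$, $\Gamma_T\ge1$,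 $\lambda=d\log T$ and $\gamma=1-\frac{\sqrt{c_\mu\Gamma_T}}{d\sqrt T}>0$. Then $R_T=\widetilde{\mathcal O}\big(\Delta^{-1}c_\mu^{-1/2}d\sqrt{\Gamma_TT}\big)$: there are an absolute exponent $p$ and a constant $K$ depending only on $S,m,k_\mu$ such that, with probability at least $1-\delta$, $$R_T\le K\,\log(T/\delta)^p\;\Delta^{-1}c_\mu^{-1/2}d\sqrt{\Gamma_TT}.$$ -/

import Mathlib

open MeasureTheory ProbabilityTheory
open scoped NNReal RealInnerProductSpace Matrix

universe u

namespace GLBandit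

noncomputable section

/-- Actions and parameters are vectors of `ℝᵈ` with the Euclidean norm. -/
abbrev Vec (d : ℕ) : Type := EuclideanSpace ℝ (Fin d)

/-- A one-parameter canonical exponential family: the reward law with natural parameter `x`
has density `r ↦ exp (r x - b x + c r)` with respect to the reference measure `ν`. -/
structure ExpFamily where
  ν : Measure ℝ
  b : ℝ → ℝ
  c : ℝ → ℝ
  measurable_c : Measurable c
  contDiff_b : ContDiff ℝ 2 b
  lintegral_density : ∀ x : ℝ,
    ∫⁻ r, ENNReal.ofReal (Real.exp (r * x - b x + c r)) ∂ν = 1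

namespace ExpFamily

/-- The log-density `log P_θ(r | a)` at `x = aᵀθ`. -/
def logDensity (F : ExpFamily) (x r : ℝ) : ℝ := r * x - F.b x + F.c r

/-- The reward law `P_θ(· | a)` at `x = aᵀθ`. -/
def law (F : ExpFamily) (x : ℝ) : Measure ℝ :=
  F.ν.withDensity fun r => ENNReal.ofReal (Real.exp (F.logDensity x r))

/-- The mean function (inverse link) `μ = b'`. -/
def mean (F : ExpFamily) : ℝ → ℝ := deriv F.b

end ExpFamily

/-- `c_μ`, the infimum of `μ'(aᵀθ)` over `‖θ‖ ≤ S` and `‖a‖ ≤ 1`. -/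
def cMu (d : ℕ) (S : ℝ) (μ : ℝ → ℝ) : ℝ :=
  sInf {y : ℝ | ∃ θ a : Vec d, ‖θ‖ ≤ S ∧ ‖a‖ ≤ 1 ∧ y = deriv μ ⟪a, θ⟫}

/-- The data of a generalized linear bandit problem together with the trajectory of a learner:
the reward family, the parameters `θ t` (that is, `θ⋆_t`), the information `ℱ t` available when
the action of round `t` is chosen, the (possibly random) action sets `A t`, the actions `a t`
and the rewards, the reward of round `t` being `r (t + 1)`. Rounds are `t = 1, 2, …`. -/
structure Run (d : ℕ) (Ω : Type u) [mΩ : MeasurableSpace Ω] where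
  family : ExpFamily
  θ : ℕ → Vec d
  ℱ : Filtration ℕ mΩ
  A : ℕ → Ω → Set (Vec d)
  a : ℕ → Ω → Vec d
  r : ℕ → Ω → ℝ

namespace Run

variable {d : ℕ} {Ω : Type u} [MeasurableSpace Ω]

/-- The interaction protocol up to the horizon `T`: the action is an element of the action set
chosen from the available information, and given that information the reward of round `t` is
drawn from `P_{θ⋆_t}(· | a_t)`. -/
structure IsInteraction (B : Run d Ω) (P : Measure Ω) (T : ℕ) : Prop where
  measurable_a : ∀ t, 1 ≤ t → t ≤ T → Measurable[B.ℱ t] (B.a t)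
  measurable_r : ∀ t, 1 ≤ t → t ≤ T → Measurable[B.ℱ (t + 1)] (B.r (t + 1))
  mem_A : ∀ t, 1 ≤ t → t ≤ T → ∀ ω, B.a t ω ∈ B.A t ω
  condLaw : ∀ t, 1 ≤ t → t ≤ T → ∀ s : Set ℝ, MeasurableSet s →
    P⟦B.r (t + 1) ⁻¹' s | B.ℱ t⟧ =ᵐ[P] fun ω => (B.family.law ⟪B.a t ω, B.θ t⟫).real s

/-- The standing assumptions: bounded actions and parameters, bounded rewards, regular mean
function with Lipschitz constant `k` and `c_μ > 0`, generalized self-concordance. -/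
structure StandingAssumptions (B : Run d Ω) (P : Measure Ω) (T : ℕ) (S m : ℝ) (k : ℝ≥0) :
    Prop where
  norm_θ_le : ∀ t, 1 ≤ t → t ≤ T → ‖B.θ t‖ ≤ S
  norm_action_le : ∀ t, 1 ≤ t → t ≤ T → ∀ ω, ∀ x ∈ B.A t ω, ‖x‖ ≤ 1
  reward_mem : ∀ t, 1 ≤ t → t ≤ T → ∀ᵐ ω ∂P, 0 ≤ B.r (t + 1) ω ∧ B.r (t + 1) ω ≤ m
  mean_contDiff : ContDiff ℝ 1 B.family.mean
  mean_lipschitz : LipschitzWith k B.family.mean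
  cMu_pos : 0 < cMu d S B.family.mean
  deriv_mean_differentiable : Differentiable ℝ (deriv B.family.mean)
  selfConcordant : ∀ x, |deriv (deriv B.family.mean) x| ≤ deriv B.family.mean x

/-- `c_μ` of the problem. -/
def cμ (B : Run d Ω) (S : ℝ) : ℝ := cMu d S B.family.mean

/-- The number of rounds `2 ≤ t ≤ T` at which the parameter changes. -/
def numChanges (B : Run d Ω) (T : ℕ) : ℕ :=
  Set.ncard {t : ℕ | 2 ≤ t ∧ t ≤ T ∧ B.θ t ≠ B.θ (t - 1)}

/-- The largest mean reward available at round `t`. -/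
def bestMean (B : Run d Ω) (t : ℕ) (ω : Ω) : ℝ :=
  sSup ((fun x : Vec d => B.family.mean ⟪x, B.θ t⟫) '' B.A t ω)

/-- Every suboptimal action of every round has a reward gap of at least `Δ`. -/
def MinGap (B : Run d Ω) (T : ℕ) (Δ : ℝ) : Prop :=
  ∀ t, 1 ≤ t → t ≤ T → ∀ ω, ∀ x ∈ B.A t ω,
    B.family.mean ⟪x, B.θ t⟫ < B.bestMean t ω →
      Δ ≤ B.bestMean t ω - B.family.mean ⟪x, B.θ t⟫

/-- The dynamic regret `R_T`. -/
def regret (B : Run d Ω) (T : ℕ) (ω : Ω) : ℝ :=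
  ∑ t ∈ Finset.Icc 1 T, (B.bestMean t ω - B.family.mean ⟪B.a t ω, B.θ t⟫)

/-- The objective whose minimizer is the weighted regularized maximum-likelihood estimator. -/
def penalizedNLL (B : Run d Ω) (lam γ : ℝ) (t : ℕ) (ω : Ω) (θ' : Vec d) : ℝ :=
  -(∑ s ∈ Finset.Icc 1 (t - 1),
      γ ^ (t - 1 - s) * B.family.logDensity ⟪B.a s ω, θ'⟫ (B.r (s + 1) ω))
    + lam / 2 * ‖θ'‖ ^ 2

/-- The weighted design matrix `V_t`. -/
def designMatrix (B : Run d Ω) (S lam γ : ℝ) (t : ℕ) (ω : Ω) : Matrix (Fin d) (Fin d) ℝ :=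
  ∑ s ∈ Finset.Icc 1 (t - 1),
      γ ^ (t - 1 - s) • Matrix.vecMulVec (B.a s ω).ofLp (B.a s ω).ofLp
    + (lam / B.cμ S) • (1 : Matrix (Fin d) (Fin d) ℝ)

end Run

/-- The weighted norm `‖x‖_M = √(xᵀ M x)`. -/
def matNorm {d : ℕ} (M : Matrix (Fin d) (Fin d) ℝ) (x : Vec d) : ℝ :=
  Real.sqrt (x.ofLp ⬝ᵥ (M *ᵥ x.ofLp))

/-- The constant `ρ_T^δ`. -/
def rho (d T : ℕ) (m k lam γ δ : ℝ) : ℝ :=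
  Real.sqrt lam / (2 * m)
    + 2 * m / Real.sqrt lam * Real.log (T / δ)
    + 2 * m / Real.sqrt lam * d * Real.log 2
    + d * m / Real.sqrt lam
        * Real.log (1 + k * (1 - 1 / (T : ℝ) ^ 2) / (d * lam * (1 - γ ^ 2)))

/-- The constant `S̄`. -/
def barS (T : ℕ) (S m k lam γ : ℝ) : ℝ :=
  S + (2 * S * k + m) / (T * lam * (1 - γ))

/-- The constant `β_T^δ`. -/
def beta (d T : ℕ) (S m k lam γ δ : ℝ) : ℝ :=
  k * Real.sqrt lam *
    (1 + barS T S m k lam γ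
      + Real.sqrt ((1 + barS T S m k lam γ) / lam) * rho d T m k lam γ δ
      + (rho d T m k lam γ δ / Real.sqrt lam) ^ 2) ^ (3 / 2 : ℝ)

namespace Run

variable {d : ℕ} {Ω : Type u} [MeasurableSpace Ω]

/-- The index `μ(xᵀ θ') + β / √c_μ · ‖x‖_{V_t⁻¹}` of the action `x` at round `t`. -/
def index (B : Run d Ω) (T : ℕ) (S m k lam γ δ : ℝ) (t : ℕ) (ω : Ω) (θ' x : Vec d) : ℝ :=
  B.family.mean ⟪x, θ'⟫
    + beta d T S m k lam γ δ / Real.sqrt (B.cμ S)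
        * matNorm (B.designMatrix S lam γ t ω)⁻¹ x

/-- The actions are those of D-GLUCB: with `θ̂_t` the weighted maximum-likelihood estimator,
`a_t` maximizes the index over the action set (ties are broken arbitrarily). -/
def IsDGLUCB (B : Run d Ω) (T : ℕ) (S m k lam γ δ : ℝ) : Prop :=
  ∀ t, 1 ≤ t → t ≤ T → ∀ ω, ∃ θhat : Vec d,
    (∀ θ' : Vec d, B.penalizedNLL lam γ t ω θhat ≤ B.penalizedNLL lam γ t ω θ') ∧
    ∀ x ∈ B.A t ω,
      B.index T S m k lam γ δ t ω θhat x ≤ B.index T S m k lam γ δ t ω θhat (B.a t ω)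

end Run

/-- The factor `T log (1/γ) + log (1 + 1 / (d λ (1 - γ)))`. -/
def logFactor (d T : ℕ) (lam γ : ℝ) : ℝ :=
  T * Real.log (1 / γ) + Real.log (1 + 1 / (d * lam * (1 - γ)))

end

end GLBandit

/-! Noise. The variance of a reward with natural parameter `x` is `μ'(x)`, so rewards in `[0, m]`
satisfy a Bernstein bound: for `‖ξ‖ ≤ 1/m`, the exponential of `⟪ξ, noise⟫` minus the conditional
variance form at `ξ` has expectation at most one. Averaging over `ξ` with a Gaussian truncated to
that ball and applying Markov's inequality bounds the noise in the dual norm of its own covariance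
by `ρ` (`measure_noise_le`). This is done for each round separately, with deterministic weights, and
summed over the `T` rounds with failure probability `δ / T` each.

Drift. The discount weights are compared with weights `w` supported on a window of length at most
`log T / (1 - γ)`. If no parameter change falls in the window, the noise entering the bound is
centred at the current parameter. The discarded weight has mass at most `1 / (T (1 - γ))` and acts
as a bias that `S̄` absorbs. At most `Γ_T` times the window length many rounds see a change in their
window, and they are charged a trivial cost.

Estimator. The estimator is not projected onto the ball of radius `S`. Generalized self-concordance
gives `μ'(x)(y-x)² ≤ (1 + |y-x|)(μ y - μ x)(y-x)`, and together with first-order optimality this is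
an implicit inequality in which the estimation error `n` also occurs inside the factor `1 + n`.
Solving it (`sqrt_one_add_mul_le`) produces the power `3/2` in `β`. Only `μ'` at the true parameter
occurs, hence `1/√c_μ` instead of `1/c_μ` (`abs_mean_sub_le`).

Regret. Optimism bounds the gap of a stable round by twice the bonus. A gap is zero or at least `Δ`,
so it is at most its square over `Δ`, and the squared bonuses are summed by the discounted
elliptical potential lemma (`sum_quadForm_inv_le`). This already gives the first and fourth terms of
part (1); the other two are nonnegative slack.

For part (2) put `q = √(c_μ Γ T)`, so that `1 - γ = q / (dT)`. If `d ≤ q` and `γ > 1/2`, then `T(1 -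
γ) ≥ 1`, `β²` is `d` up to logarithms, and both terms are of order `d q / (c_μ Δ)`. Otherwise this
rate exceeds a constant multiple of the trivial bound `T m² / Δ`. -/

namespace GLBandit

/-! ### Exponential families: moments and a Bernstein bound -/

namespace ExpFamily

variable (F : ExpFamily)

lemma measurable_density (x : ℝ) :
    Measurable fun r => ENNReal.ofReal (Real.exp (F.logDensity x r)) := by
  have := F.measurable_c
  unfold logDensity
  fun_prop

instance isProbabilityMeasure_law (x : ℝ) : IsProbabilityMeasure (F.law x) := by
  refine ⟨?_⟩
  rw [law, withDensity_apply _ MeasurableSet.univ, Measure.restrict_univ]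
  exact F.lintegral_density x

/-- The density is strictly positive. All laws of the family thus share their null sets, which
carries the reward range from one natural parameter to all of them. -/
lemma law_eq_zero_iff (x : ℝ) (s : Set ℝ) : F.law x s = 0 ↔ F.ν s = 0 := by
  rw [law, withDensity_apply_eq_zero (F.measurable_density x)]
  have : {r | ENNReal.ofReal (Real.exp (F.logDensity x r)) ≠ 0} = Set.univ := by
    ext r
    simp [Real.exp_pos]
  rw [this, Set.univ_inter]

lemma law_eq_withDensity (x y : ℝ) :
    F.law x = (F.law y).withDensity
      fun r => ENNReal.ofReal (Real.exp (r * (x - y) - F.b x + F.b y)) := by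
  rw [law, law, ← withDensity_mul _ (F.measurable_density y) (by fun_prop)]
  congr 1
  ext r
  rw [Pi.mul_apply, ← ENNReal.ofReal_mul (Real.exp_pos _).le, ← Real.exp_add]
  congr 2
  unfold logDensity
  ring

lemma lintegral_exp_mul (x t : ℝ) :
    ∫⁻ r, ENNReal.ofReal (Real.exp (t * r)) ∂F.law x
      = ENNReal.ofReal (Real.exp (F.b (x + t) - F.b x)) := by
  rw [law, lintegral_withDensity_eq_lintegral_mul _ (F.measurable_density x) (by fun_prop)]
  have h : ∀ r, ((fun r => ENNReal.ofReal (Real.exp (F.logDensity x r)))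
        * fun r => ENNReal.ofReal (Real.exp (t * r))) r
      = ENNReal.ofReal (Real.exp (F.b (x + t) - F.b x))
        * ENNReal.ofReal (Real.exp (r * (x + t) - F.b (x + t) + F.c r)) := by
    intro r
    rw [Pi.mul_apply, ← ENNReal.ofReal_mul (Real.exp_pos _).le, ← Real.exp_add,
      ← ENNReal.ofReal_mul (Real.exp_pos _).le, ← Real.exp_add]
    congr 2
    unfold logDensity
    ring
  simp_rw [h]
  rw [lintegral_const_mul' _ _ ENNReal.ofReal_ne_top, F.lintegral_density, mul_one]

lemma integrable_exp_mul (x t : ℝ) : Integrable (fun r => Real.exp (t * r)) (F.law x) := by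
  refine ⟨by fun_prop, ?_⟩
  rw [hasFiniteIntegral_iff_ofReal (Filter.Eventually.of_forall fun r => (Real.exp_pos _).le),
    F.lintegral_exp_mul]
  exact ENNReal.ofReal_lt_top

/-- Normalization at the parameter `x + t` computes the moment generating function. Mean and
variance then follow by differentiating at `t = 0`. -/
lemma cgf_law (x : ℝ) : cgf id (F.law x) = fun t => F.b (x + t) - F.b x := by
  ext t
  rw [cgf, mgf]
  simp only [id]
  rw [integral_eq_lintegral_of_nonneg_ae
    (Filter.Eventually.of_forall fun r => (Real.exp_pos _).le) (by fun_prop),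
    F.lintegral_exp_mul, ENNReal.toReal_ofReal (Real.exp_pos _).le, Real.log_exp]

lemma interior_integrableExpSet_law (x : ℝ) :
    interior (integrableExpSet id (F.law x)) = Set.univ := by
  have : integrableExpSet id (F.law x) = Set.univ := by
    ext t
    simp only [Set.mem_univ, iff_true]
    exact F.integrable_exp_mul x t
  rw [this, interior_univ]

lemma deriv_cgf_law (x t : ℝ) : deriv (cgf id (F.law x)) t = F.mean (x + t) := by
  rw [F.cgf_law, deriv_sub_const, deriv_comp_const_add]
  rfl

lemma integral_law (x : ℝ) : ∫ r, r ∂F.law x = F.mean x := by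
  have h := deriv_cgf_zero (X := id) (μ := F.law x) (by simp [F.interior_integrableExpSet_law])
  rw [F.deriv_cgf_law] at h
  simpa using h.symm

lemma integral_sq_law (x : ℝ) : ∫ r, (r - F.mean x) ^ 2 ∂F.law x = deriv F.mean x := by
  have h := iteratedDeriv_two_cgf_eq_integral (X := id) (μ := F.law x) (v := 0)
    (by simp [F.interior_integrableExpSet_law])
  rw [iteratedDeriv_succ, iteratedDeriv_one, F.deriv_cgf_law] at h
  have h2 : deriv (cgf id (F.law x)) = fun t => F.mean (x + t) := funext (F.deriv_cgf_law x)
  rw [h2, deriv_comp_const_add] at h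
  simpa using h.symm

variable {F} {m : ℝ}

lemma ae_law_mem (hν : F.ν (Set.Icc 0 m)ᶜ = 0) (x : ℝ) : ∀ᵐ r ∂F.law x, r ∈ Set.Icc 0 m := by
  rw [ae_iff]
  exact (F.law_eq_zero_iff x _).2 hν

lemma integrable_id_law (hν : F.ν (Set.Icc 0 m)ᶜ = 0) (x : ℝ) :
    Integrable (fun r : ℝ => r) (F.law x) :=
  Integrable.of_bound (C := m) (by fun_prop) <| by
    filter_upwards [ae_law_mem hν x] with r hr
    rw [Real.norm_eq_abs, abs_of_nonneg hr.1]
    exact hr.2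

lemma mean_mem (hν : F.ν (Set.Icc 0 m)ᶜ = 0) (x : ℝ) : F.mean x ∈ Set.Icc 0 m := by
  rw [← F.integral_law]
  constructor
  · exact integral_nonneg_of_ae ((ae_law_mem hν x).mono fun r hr => hr.1)
  · calc ∫ r, r ∂F.law x ≤ ∫ _, m ∂F.law x :=
        integral_mono_ae (integrable_id_law hν x) (integrable_const m)
          ((ae_law_mem hν x).mono fun r hr => hr.2)
      _ = m := by simp

/-- Bernstein-type bound on the exponential moments of a centred bounded reward. -/
lemma lintegral_exp_centred_le_one (hν : F.ν (Set.Icc 0 m)ᶜ = 0) (x ξ : ℝ) (hξ : |ξ| * m ≤ 1) :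
    ∫⁻ r, ENNReal.ofReal (Real.exp (ξ * (r - F.mean x) - ξ ^ 2 * deriv F.mean x)) ∂F.law x
      ≤ 1 := by
  have hle : ∀ᵐ r ∂F.law x, |r - F.mean x| ≤ m := by
    filter_upwards [ae_law_mem hν x] with r hr
    have := mean_mem hν x
    exact abs_sub_le_of_nonneg_of_le hr.1 hr.2 this.1 this.2
  have hint : Integrable (fun r => r - F.mean x) (F.law x) :=
    (integrable_id_law hν x).sub (integrable_const _)
  have hsq : Integrable (fun r => (r - F.mean x) ^ 2) (F.law x) :=
    Integrable.of_bound (C := m ^ 2) (by fun_prop) <| by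
      filter_upwards [hle] with r hr
      rw [Real.norm_eq_abs, abs_pow]
      gcongr
  -- Majorant from `exp y ≤ 1 + y + y²` for `|y| ≤ 1`. Its integral `1 + ξ² μ'` is at most `exp (ξ²
  -- μ')`, so the exponent subtracts the full variance and not half of it.
  set q : ℝ → ℝ := fun r => 1 + ξ * (r - F.mean x) + ξ ^ 2 * (r - F.mean x) ^ 2 with hq
  have hqi : Integrable q (F.law x) :=
    ((integrable_const 1).add (hint.const_mul ξ)).add (hsq.const_mul (ξ ^ 2))
  have hq_int : ∫ r, q r ∂F.law x = 1 + ξ ^ 2 * deriv F.mean x := by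
    have h1 : ∫ r, (r - F.mean x) ∂F.law x = 0 := by
      rw [integral_sub (integrable_id_law hν x) (integrable_const _), F.integral_law]
      simp
    refine (integral_add (f := fun r => 1 + ξ * (r - F.mean x))
      ((integrable_const 1).add (hint.const_mul ξ)) (hsq.const_mul (ξ ^ 2))).trans ?_
    rw [integral_add (integrable_const 1) (hint.const_mul ξ), integral_const_mul,
      integral_const_mul, h1, F.integral_sq_law]
    simp
  have hexp : ∀ᵐ r ∂F.law x, Real.exp (ξ * (r - F.mean x)) ≤ q r := by
    filter_upwards [hle] with r hr
    have h1 : |ξ * (r - F.mean x)| ≤ 1 := by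
      rw [abs_mul]
      exact (mul_le_mul_of_nonneg_left hr (abs_nonneg _)).trans hξ
    have := (abs_le.1 (Real.abs_exp_sub_one_sub_id_le h1)).2
    simp only [hq]
    nlinarith
  have hq0 : 0 ≤ᵐ[F.law x] q := hexp.mono fun r hr => (Real.exp_pos _).le.trans hr
  calc ∫⁻ r, ENNReal.ofReal (Real.exp (ξ * (r - F.mean x) - ξ ^ 2 * deriv F.mean x)) ∂F.law x
      ≤ ∫⁻ r, ENNReal.ofReal (Real.exp (-(ξ ^ 2 * deriv F.mean x)))
          * ENNReal.ofReal (q r) ∂F.law x := by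
        refine lintegral_mono_ae (hexp.mono fun r hr => ?_)
        rw [← ENNReal.ofReal_mul (Real.exp_pos _).le, sub_eq_neg_add, Real.exp_add]
        gcongr
    _ = ENNReal.ofReal (Real.exp (-(ξ ^ 2 * deriv F.mean x)) * (1 + ξ ^ 2 * deriv F.mean x)) := by
        rw [lintegral_const_mul' _ _ ENNReal.ofReal_ne_top,
          ← ofReal_integral_eq_lintegral_ofReal hqi hq0, hq_int,
          ENNReal.ofReal_mul (Real.exp_pos _).le]
    _ ≤ 1 := by
        rw [← ENNReal.ofReal_one]
        apply ENNReal.ofReal_le_ofReal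
        rw [Real.exp_neg, inv_mul_le_one₀ (Real.exp_pos _)]
        linarith [Real.add_one_le_exp (ξ ^ 2 * deriv F.mean x)]

end ExpFamily

/-! ### Generalized self-concordance -/

section SelfConcordance

variable {μ : ℝ → ℝ}

lemma deriv_nonneg_of_selfConcordant (hsc : ∀ x, |deriv (deriv μ) x| ≤ deriv μ x) (x : ℝ) :
    0 ≤ deriv μ x :=
  (abs_nonneg _).trans (hsc x)

/-- Since `μ'' ≥ -μ'`, the function `v ↦ μ'(x + v) exp v` is nondecreasing. -/
lemma deriv_mul_exp_neg_le (hd : Differentiable ℝ (deriv μ))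
    (hsc : ∀ x, |deriv (deriv μ) x| ≤ deriv μ x) (x : ℝ) {h : ℝ} (hh : 0 ≤ h) :
    deriv μ x * Real.exp (-h) ≤ deriv μ (x + h) := by
  have hder : ∀ v, HasDerivAt (fun v => deriv μ (x + v) * Real.exp v)
      (deriv (deriv μ) (x + v) * Real.exp v + deriv μ (x + v) * Real.exp v) v := fun v =>
    ((hd (x + v)).hasDerivAt.comp_const_add x v).mul (Real.hasDerivAt_exp v)
  have hmono : Monotone fun v => deriv μ (x + v) * Real.exp v := by
    refine monotone_of_hasDerivAt_nonneg hder fun v => ?_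
    have := (abs_le.1 (hsc (x + v))).1
    have h2 := Real.exp_pos v
    simp only [Pi.zero_apply]
    nlinarith
  have := hmono hh
  simp only [add_zero, Real.exp_zero, mul_one] at this
  rw [Real.exp_neg, ← div_eq_mul_inv, div_le_iff₀ (Real.exp_pos h)]
  exact this

/-- Integrating the exponential lower bound on `μ'` gives the factor `1 - exp (-h)`, which is at
least `h / (1 + h)`. -/
lemma div_one_add_le_sub_of_selfConcordant (hμ : Differentiable ℝ μ)
    (hd : Differentiable ℝ (deriv μ))
    (hsc : ∀ x, |deriv (deriv μ) x| ≤ deriv μ x) (x : ℝ) {h : ℝ} (hh : 0 ≤ h) :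
    deriv μ x * (h / (1 + h)) ≤ μ (x + h) - μ x := by
  have hder : ∀ v, HasDerivAt (fun v => μ (x + v) + deriv μ x * Real.exp (-v))
      (deriv μ (x + v) + deriv μ x * (Real.exp (-v) * -1)) v := fun v =>
    ((hμ (x + v)).hasDerivAt.comp_const_add x v).add
      (((hasDerivAt_neg v).exp).const_mul _)
  have hmono : MonotoneOn (fun v => μ (x + v) + deriv μ x * Real.exp (-v)) (Set.Ici 0) := by
    refine monotoneOn_of_deriv_nonneg (convex_Ici 0)
      (fun v _ => (hder v).continuousAt.continuousWithinAt)
      (fun v _ => (hder v).differentiableAt.differentiableWithinAt) fun v hv => ?_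
    rw [interior_Ici] at hv
    rw [(hder v).deriv]
    linarith [deriv_mul_exp_neg_le hd hsc x (le_of_lt hv)]
  have h1 := hmono (Set.mem_Ici.2 le_rfl) (Set.mem_Ici.2 hh) hh
  simp only [add_zero, neg_zero, Real.exp_zero, mul_one] at h1
  have h2 : h / (1 + h) ≤ 1 - Real.exp (-h) := by
    have h3 : Real.exp (-h) ≤ 1 / (1 + h) := by
      rw [Real.exp_neg, ← one_div]
      exact one_div_le_one_div_of_le (by linarith) (by linarith [Real.add_one_le_exp h])
    have : h / (1 + h) = 1 - 1 / (1 + h) := by field_simp; ring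
    linarith
  nlinarith [deriv_nonneg_of_selfConcordant hsc x]

/-- A generalized self-concordant function is at least as steep between two points as its
derivative at one of them, up to the distance of the points. -/
lemma selfConcordant_sub_mul_sub (hμ : Differentiable ℝ μ) (hd : Differentiable ℝ (deriv μ))
    (hsc : ∀ x, |deriv (deriv μ) x| ≤ deriv μ x) (x y : ℝ) :
    deriv μ x * (y - x) ^ 2 / (1 + |y - x|) ≤ (μ y - μ x) * (y - x) := by
  rcases le_total x y with h | h
  · have h1 := div_one_add_le_sub_of_selfConcordant hμ hd hsc x (sub_nonneg.2 h)
    rw [add_sub_cancel] at h1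
    rw [abs_of_nonneg (sub_nonneg.2 h)]
    calc deriv μ x * (y - x) ^ 2 / (1 + (y - x))
        = deriv μ x * ((y - x) / (1 + (y - x))) * (y - x) := by ring
      _ ≤ _ := mul_le_mul_of_nonneg_right h1 (sub_nonneg.2 h)
  -- Steps to the left reduce to steps to the right for the reflected function `v ↦ -μ(-v)`, which
  -- is again self-concordant.
  · have hr : ∀ z, deriv (fun v => -μ (-v)) z = deriv μ (-z) := by
      intro z
      have h1 : HasDerivAt (fun v => -μ (-v)) (-(deriv μ (-z) * -1)) z :=
        ((hμ (-z)).hasDerivAt.comp z (hasDerivAt_neg z)).neg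
      simpa using h1.deriv
    have hrf : deriv (fun v => -μ (-v)) = fun z => deriv μ (-z) := funext hr
    have hsc' : ∀ z, |deriv (deriv fun v => -μ (-v)) z| ≤ deriv (fun v => -μ (-v)) z := by
      intro z
      rw [hrf, deriv_comp_neg, abs_neg]
      exact hsc _
    have h1 := div_one_add_le_sub_of_selfConcordant (μ := fun v => -μ (-v))
      (by fun_prop) (by rw [hrf]; fun_prop) hsc' (-x) (h := x - y) (sub_nonneg.2 h)
    rw [hr] at h1
    simp only [neg_neg, neg_add, neg_sub] at h1
    rw [show x + (y - x) = y by ring] at h1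
    rw [abs_of_nonpos (sub_nonpos.2 h), neg_sub]
    have h2 := mul_le_mul_of_nonneg_right h1 (sub_nonneg.2 h)
    calc deriv μ x * (y - x) ^ 2 / (1 + (x - y))
        = deriv μ x * ((x - y) / (1 + (x - y))) * (x - y) := by ring
      _ ≤ _ := h2
      _ = _ := by ring

end SelfConcordance

end GLBandit

/-! ### Quadratic forms, Gram matrices and determinants -/

namespace GLBandit

noncomputable section

variable {d : ℕ}

/-- The quadratic form `xᵀ M x`. -/
def quadForm (M : Matrix (Fin d) (Fin d) ℝ) (x : Vec d) : ℝ := x.ofLp ⬝ᵥ (M *ᵥ x.ofLp)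

/-- The regularized weighted Gram matrix `∑ wᵢ aᵢ aᵢᵀ + c I`. -/
def gram (I : Finset ℕ) (w : ℕ → ℝ) (a : ℕ → Vec d) (c : ℝ) : Matrix (Fin d) (Fin d) ℝ :=
  ∑ i ∈ I, w i • Matrix.vecMulVec (a i).ofLp (a i).ofLp + c • (1 : Matrix (Fin d) (Fin d) ℝ)

lemma dotProduct_ofLp (x y : Vec d) : x.ofLp ⬝ᵥ y.ofLp = ⟪x, y⟫ := by
  rw [EuclideanSpace.inner_eq_star_dotProduct, dotProduct_comm]
  simp

lemma matNorm_eq_sqrt (M : Matrix (Fin d) (Fin d) ℝ) (x : Vec d) :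
    matNorm M x = Real.sqrt (quadForm M x) := rfl

lemma quadForm_vecMulVec (u x : Vec d) :
    quadForm (Matrix.vecMulVec u.ofLp u.ofLp) x = ⟪u, x⟫ ^ 2 := by
  rw [quadForm, Matrix.vecMulVec_mulVec, op_smul_eq_smul, dotProduct_smul, smul_eq_mul,
    dotProduct_ofLp u x, dotProduct_ofLp x u, real_inner_comm, sq]

lemma quadForm_gram (I : Finset ℕ) (w : ℕ → ℝ) (a : ℕ → Vec d) (c : ℝ) (x : Vec d) :
    quadForm (gram I w a c) x = ∑ i ∈ I, w i * ⟪a i, x⟫ ^ 2 + c * ‖x‖ ^ 2 := by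
  rw [quadForm, gram, Matrix.add_mulVec, dotProduct_add, Matrix.sum_mulVec, dotProduct_sum]
  congr 1
  · refine Finset.sum_congr rfl fun i _ => ?_
    rw [Matrix.smul_mulVec, dotProduct_smul, smul_eq_mul, ← quadForm_vecMulVec, quadForm]
  · rw [Matrix.smul_mulVec, dotProduct_smul, Matrix.one_mulVec, dotProduct_ofLp,
      real_inner_self_eq_norm_sq, smul_eq_mul]

lemma gram_isHermitian (I : Finset ℕ) (w : ℕ → ℝ) (a : ℕ → Vec d) (c : ℝ) :
    (gram I w a c).IsHermitian := by
  simp [Matrix.IsHermitian, gram, Matrix.transpose_sum, Matrix.transpose_vecMulVec]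

lemma trace_gram (I : Finset ℕ) (w : ℕ → ℝ) (a : ℕ → Vec d) (c : ℝ) :
    (gram I w a c).trace = ∑ i ∈ I, w i * ‖a i‖ ^ 2 + c * d := by
  rw [gram, Matrix.trace_add, Matrix.trace_sum]
  congr 1
  · refine Finset.sum_congr rfl fun i _ => ?_
    rw [Matrix.trace_smul, Matrix.trace_vecMulVec, dotProduct_ofLp, real_inner_self_eq_norm_sq,
      smul_eq_mul]
  · simp

lemma gram_posDef {I : Finset ℕ} {w : ℕ → ℝ} (a : ℕ → Vec d) {c : ℝ}
    (hw : ∀ i ∈ I, 0 ≤ w i) (hc : 0 < c) : (gram I w a c).PosDef := by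
  refine Matrix.PosDef.of_dotProduct_mulVec_pos (gram_isHermitian I w a c) fun x hx => ?_
  have h := quadForm_gram I w a c (WithLp.toLp 2 x)
  rw [quadForm] at h
  simp only [star_trivial]
  rw [h]
  have h1 : 0 ≤ ∑ i ∈ I, w i * ⟪a i, WithLp.toLp 2 x⟫ ^ 2 :=
    Finset.sum_nonneg fun i hi => mul_nonneg (hw i hi) (sq_nonneg _)
  have h2 : 0 < ‖WithLp.toLp 2 x‖ := norm_pos_iff.2 (by simpa using hx)
  positivity

lemma quadForm_nonneg {M : Matrix (Fin d) (Fin d) ℝ} (hM : M.PosDef) (x : Vec d) :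
    0 ≤ quadForm M x := by
  simpa [quadForm] using hM.posSemidef.dotProduct_mulVec_nonneg x.ofLp

lemma quadForm_pos {M : Matrix (Fin d) (Fin d) ℝ} (hM : M.PosDef) {x : Vec d} (hx : x ≠ 0) :
    0 < quadForm M x := by
  have h : x.ofLp ≠ 0 := by simpa using hx
  simpa [quadForm] using hM.dotProduct_mulVec_pos h

/-- Cauchy–Schwarz for the dual pair of norms of a positive definite matrix. -/
lemma inner_sq_le_quadForm_inv_mul {M : Matrix (Fin d) (Fin d) ℝ} (hM : M.PosDef) (x z : Vec d) :
    ⟪x, z⟫ ^ 2 ≤ quadForm M⁻¹ x * quadForm M z := by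
  have hdet : IsUnit M.det := (Matrix.isUnit_iff_isUnit_det M).1 hM.isUnit
  have hsymm : Mᵀ = M := by simpa [Matrix.IsHermitian] using hM.isHermitian
  set y : Fin d → ℝ := M⁻¹ *ᵥ x.ofLp with hy
  have hMy : M *ᵥ y = x.ofLp := by
    rw [hy, Matrix.mulVec_mulVec, Matrix.mul_nonsing_inv _ hdet, Matrix.one_mulVec]
  have hyz : y ⬝ᵥ (M *ᵥ z.ofLp) = ⟪x, z⟫ := by
    rw [Matrix.dotProduct_mulVec, ← Matrix.mulVec_transpose, hsymm, hMy, dotProduct_ofLp]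
  -- The form `M` at `z - t • M⁻¹x` is a nonnegative quadratic polynomial in `t`; its discriminant
  -- gives the claim.
  have hexp : ∀ t : ℝ, 0 ≤ quadForm M⁻¹ x * (t * t) + (-2 * ⟪x, z⟫) * t + quadForm M z := by
    intro t
    have h := hM.posSemidef.dotProduct_mulVec_nonneg (z.ofLp - t • y)
    simp only [star_trivial, Matrix.mulVec_sub, Matrix.mulVec_smul, sub_dotProduct,
      dotProduct_sub, smul_dotProduct, dotProduct_smul, hMy, hyz, smul_eq_mul] at h
    have h5 : z.ofLp ⬝ᵥ x.ofLp = ⟪x, z⟫ := by rw [dotProduct_ofLp, real_inner_comm]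
    have h3 : y ⬝ᵥ x.ofLp = quadForm M⁻¹ x := by rw [dotProduct_comm]; rfl
    have h4 : z.ofLp ⬝ᵥ M *ᵥ z.ofLp = quadForm M z := rfl
    rw [h3, h4, h5] at h
    linarith
  have := discrim_le_zero hexp
  rw [discrim] at this
  linarith

lemma abs_inner_le_matNorm_inv_mul {M : Matrix (Fin d) (Fin d) ℝ} (hM : M.PosDef) (x z : Vec d) :
    |⟪x, z⟫| ≤ matNorm M⁻¹ x * Real.sqrt (quadForm M z) := by
  rw [matNorm_eq_sqrt, ← Real.sqrt_mul (quadForm_nonneg hM.inv x)]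
  exact Real.abs_le_sqrt (inner_sq_le_quadForm_inv_mul hM x z)

lemma quadForm_inv_eq {M : Matrix (Fin d) (Fin d) ℝ} (hM : M.PosDef) (x : Vec d) :
    quadForm M (WithLp.toLp 2 (M⁻¹ *ᵥ x.ofLp)) = quadForm M⁻¹ x
      ∧ ⟪x, WithLp.toLp 2 (M⁻¹ *ᵥ x.ofLp)⟫ = quadForm M⁻¹ x := by
  have hdet : IsUnit M.det := (Matrix.isUnit_iff_isUnit_det M).1 hM.isUnit
  constructor
  · rw [quadForm, Matrix.mulVec_mulVec, Matrix.mul_nonsing_inv _ hdet, Matrix.one_mulVec,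
      dotProduct_comm]
    rfl
  · rw [← dotProduct_ofLp]
    rfl

/-- Inversion reverses the order of positive definite quadratic forms. -/
lemma quadForm_inv_anti {A M : Matrix (Fin d) (Fin d) ℝ} (hA : A.PosDef) (hM : M.PosDef)
    (h : ∀ x, quadForm A x ≤ quadForm M x) (x : Vec d) : quadForm M⁻¹ x ≤ quadForm A⁻¹ x := by
  obtain ⟨h1, h2⟩ := quadForm_inv_eq hM x
  -- Cauchy–Schwarz for `A`, tested at `M⁻¹x`, bounds the square of `xᵀM⁻¹x`; one factor then
  -- cancels.
  have h3 := inner_sq_le_quadForm_inv_mul hA x (WithLp.toLp 2 (M⁻¹ *ᵥ x.ofLp))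
  have h4 := h (WithLp.toLp 2 (M⁻¹ *ᵥ x.ofLp))
  rw [h1] at h4
  rw [h2] at h3
  have h5 := quadForm_nonneg hM.inv x
  have h6 := quadForm_nonneg hA.inv x
  have h7 : quadForm M⁻¹ x ^ 2 ≤ quadForm A⁻¹ x * quadForm M⁻¹ x :=
    h3.trans (mul_le_mul_of_nonneg_left h4 h6)
  rcases h5.eq_or_lt with h0 | h0
  · rw [← h0]; exact h6
  · exact le_of_mul_le_mul_right (by linarith) h0

/-- The inequality of arithmetic and geometric means for the eigenvalues. -/
lemma log_det_le {M : Matrix (Fin d) (Fin d) ℝ} (hM : M.PosDef) {v : ℝ}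
    (htr : M.trace ≤ d * v) (hv : 0 < v) : Real.log M.det ≤ d * Real.log v := by
  have hdet := hM.isHermitian.det_eq_prod_eigenvalues
  have htrace := hM.isHermitian.trace_eq_sum_eigenvalues
  simp only [RCLike.ofReal_real_eq_id, id] at hdet htrace
  rw [hdet, Real.log_prod (fun i _ => (hM.eigenvalues_pos i).ne')]
  have h1 : ∀ i, Real.log (hM.isHermitian.eigenvalues i)
      ≤ Real.log v + (hM.isHermitian.eigenvalues i / v - 1) := fun i => by
    have h2 := Real.log_le_sub_one_of_pos (div_pos (hM.eigenvalues_pos i) hv)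
    rw [Real.log_div (hM.eigenvalues_pos i).ne' hv.ne'] at h2
    linarith
  calc ∑ i, Real.log (hM.isHermitian.eigenvalues i)
      ≤ ∑ i, (Real.log v + (hM.isHermitian.eigenvalues i / v - 1)) :=
        Finset.sum_le_sum fun i _ => h1 i
    _ = d * Real.log v + (M.trace / v - d) := by
        rw [htrace, Finset.sum_add_distrib, Finset.sum_sub_distrib, ← Finset.sum_div]
        simp
    _ ≤ d * Real.log v := by
        have : M.trace / v ≤ d := (div_le_iff₀ hv).2 htr
        linarith

/-- The matrix determinant lemma for one step of a discounted design matrix. -/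
lemma det_smul_add_vecMulVec {M : Matrix (Fin d) (Fin d) ℝ} (hM : M.PosDef) {γ : ℝ} (hγ : 0 < γ)
    (x : Vec d) :
    (γ • M + Matrix.vecMulVec x.ofLp x.ofLp).det
      = γ ^ d * M.det * (1 + γ⁻¹ * quadForm M⁻¹ x) := by
  have hdet : IsUnit M.det := (Matrix.isUnit_iff_isUnit_det M).1 hM.isUnit
  have hdet' : IsUnit (γ • M).det := by
    rw [Matrix.det_smul]
    exact (IsUnit.mk0 _ (pow_pos hγ _).ne').mul hdet
  rw [Matrix.vecMulVec_eq Unit, Matrix.det_add_replicateCol_mul_replicateRow hdet',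
    Matrix.det_smul, Fintype.card_fin, Matrix.det_unique (n := Unit)]
  congr 2
  have hinv : (γ • M)⁻¹ = γ⁻¹ • M⁻¹ := by
    refine Matrix.inv_eq_left_inv ?_
    rw [Matrix.smul_mul, Matrix.mul_smul, smul_smul, inv_mul_cancel₀ hγ.ne', one_smul,
      Matrix.nonsing_inv_mul _ hdet]
  rw [hinv, quadForm, Matrix.dotProduct_mulVec]
  simp [Matrix.mul_apply, dotProduct, Matrix.vecMul, Finset.mul_sum, Finset.sum_mul, mul_assoc]

open scoped MatrixOrder Matrix.Norms.L2Operator in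
lemma exists_transpose_mul_self {M : Matrix (Fin d) (Fin d) ℝ} (hM : M.PosDef) :
    ∃ C : Matrix (Fin d) (Fin d) ℝ, M = Cᵀ * C := by
  obtain ⟨C, hC⟩ := CStarAlgebra.nonneg_iff_eq_star_mul_self.mp hM.posSemidef.nonneg
  exact ⟨C, by simpa [Matrix.star_eq_conjTranspose] using hC⟩

/-- A positive definite form is the squared norm of a linear image. -/
lemma exists_linearMap_norm_sq_eq {M : Matrix (Fin d) (Fin d) ℝ} (hM : M.PosDef) :
    ∃ f : Vec d →ₗ[ℝ] Vec d, (∀ x, ‖f x‖ ^ 2 = quadForm M x) ∧ LinearMap.det f ^ 2 = M.det := by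
  obtain ⟨C, hC⟩ := exists_transpose_mul_self hM
  refine ⟨Matrix.toLpLin 2 2 C, fun x => ?_, ?_⟩
  · rw [← real_inner_self_eq_norm_sq, ← dotProduct_ofLp, Matrix.ofLp_toLpLin,
      Matrix.toLin'_apply, quadForm, hC, ← Matrix.mulVec_mulVec, Matrix.dotProduct_mulVec x.ofLp,
      Matrix.vecMul_transpose]
  · rw [Matrix.toLpLin_eq_toLin, LinearMap.det_toLin, hC, Matrix.det_mul,
      Matrix.det_transpose, sq]

end

end GLBandit

/-! ### Mixtures over a truncated Gaussian -/

namespace GLBandit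

noncomputable section

variable {d : ℕ}

/-- The Gaussian mass of the ball of radius `R`, the normalization of the mixing density. -/
def ballMass (d : ℕ) (lam R : ℝ) : ENNReal :=
  ∫⁻ ξ in Metric.closedBall (0 : Vec d) R, ENNReal.ofReal (Real.exp (-(lam * ‖ξ‖ ^ 2)))

lemma ballMass_ne_top (d : ℕ) {lam : ℝ} (hlam : 0 ≤ lam) (R : ℝ) : ballMass d lam R ≠ ⊤ := by
  refine ne_top_of_le_ne_top (measure_closedBall_lt_top (μ := volume) (x := (0 : Vec d)) (r := R)).ne ?_
  calc ballMass d lam R ≤ ∫⁻ _ in Metric.closedBall (0 : Vec d) R, 1 ∂volume := by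
        refine lintegral_mono fun ξ => ?_
        rw [← ENNReal.ofReal_one]
        refine ENNReal.ofReal_le_ofReal (Real.exp_le_one_iff.2 ?_)
        have := mul_nonneg hlam (sq_nonneg ‖ξ‖)
        linarith
    _ = _ := by simp

lemma ballMass_ne_zero (d : ℕ) (lam : ℝ) {R : ℝ} (hR : 0 < R) : ballMass d lam R ≠ 0 := by
  intro h
  rw [ballMass, lintegral_eq_zero_iff (by fun_prop)] at h
  have h2 : ∀ᵐ ξ ∂volume.restrict (Metric.closedBall (0 : Vec d) R), False := by
    filter_upwards [h] with ξ hξ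
    simp only [Pi.zero_apply, ENNReal.ofReal_eq_zero] at hξ
    exact (Real.exp_pos _).not_ge hξ
  rw [ae_iff] at h2
  simp only [not_false_eq_true, Set.ofPred_true, Measure.restrict_apply_univ] at h2
  exact (Metric.measure_closedBall_pos volume (0 : Vec d) hR).ne' h2

lemma lintegral_comp_linearMap {f : Vec d →ₗ[ℝ] Vec d} (hf : LinearMap.det f ≠ 0)
    {k : Vec d → ENNReal} (hk : Measurable k) :
    ∫⁻ x, k (f x) = ENNReal.ofReal |(LinearMap.det f)⁻¹| * ∫⁻ x, k x := by
  have hm : Measurable f := f.continuous_of_finiteDimensional.measurable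
  rw [← lintegral_map hk hm, Measure.map_linearMap_addHaar_eq_smul_addHaar volume hf,
    lintegral_smul_measure, smul_eq_mul]

/-- Gaussian mass of an ellipsoid compared with that of a ball of twice the radius. -/
lemma ballMass_le_lintegral_ellipsoid {f : Vec d →ₗ[ℝ] Vec d} (hf : LinearMap.det f ≠ 0)
    {lam : ℝ} (hlam : 0 < lam) (hle : ∀ x, lam * ‖x‖ ^ 2 ≤ ‖f x‖ ^ 2) (R : ℝ) :
    ENNReal.ofReal ((Real.sqrt lam / 2) ^ d * |LinearMap.det f|⁻¹) * ballMass d lam R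
      ≤ ∫⁻ η in Metric.closedBall (0 : Vec d) (R / 2),
          ENNReal.ofReal (Real.exp (-‖f η‖ ^ 2)) := by
  have hs : 0 < Real.sqrt lam := Real.sqrt_pos.2 hlam
  have hdet : LinearMap.det ((2 / Real.sqrt lam) • f)
      = (2 / Real.sqrt lam) ^ d * LinearMap.det f := by
    rw [LinearMap.det_smul, finrank_euclideanSpace, Fintype.card_fin]
  set k : Vec d → ENNReal := (Metric.closedBall (0 : Vec d) R).indicator
    fun ξ => ENNReal.ofReal (Real.exp (-(lam * ‖ξ‖ ^ 2))) with hk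
  have hkm : Measurable k := Measurable.indicator (by fun_prop) Metric.isClosed_closedBall.measurableSet
  have h1 : ∫⁻ x, k x = ballMass d lam R := by
    rw [hk, lintegral_indicator Metric.isClosed_closedBall.measurableSet, ballMass]
  -- Change of variables by `(2/√λ) f`. As `√λ ‖η‖ ≤ ‖f η‖`, the preimage of the ball of radius `R`
  -- lies in the ball of radius `R / 2`. The factor `2` costs `2 ^ d` in the determinant, the source
  -- of `d log 2` in `ρ`.
  have h2 := lintegral_comp_linearMap (f := (2 / Real.sqrt lam) • f) (k := k)
    (by rw [hdet]; positivity) hkm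
  have h3 : |(LinearMap.det ((2 / Real.sqrt lam) • f))⁻¹|
      = (Real.sqrt lam / 2) ^ d * |LinearMap.det f|⁻¹ := by
    rw [hdet, mul_inv, abs_mul, abs_inv, abs_inv, abs_of_nonneg (by positivity), ← inv_pow, inv_div]
  rw [h1, h3] at h2
  rw [← h2, ← lintegral_indicator Metric.isClosed_closedBall.measurableSet]
  refine lintegral_mono fun η => ?_
  have hn : ‖((2 / Real.sqrt lam) • f) η‖ = 2 / Real.sqrt lam * ‖f η‖ := by
    rw [LinearMap.smul_apply, norm_smul, Real.norm_of_nonneg (by positivity)]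
  by_cases hη : ((2 / Real.sqrt lam) • f) η ∈ Metric.closedBall (0 : Vec d) R
  · have hη' : η ∈ Metric.closedBall (0 : Vec d) (R / 2) := by
      rw [mem_closedBall_zero_iff] at hη ⊢
      rw [hn] at hη
      have h4 : Real.sqrt lam * ‖η‖ ≤ ‖f η‖ := by
        refine le_of_sq_le_sq ?_ (norm_nonneg _)
        rw [mul_pow, Real.sq_sqrt hlam.le]
        exact hle η
      have h5 : 2 / Real.sqrt lam * (Real.sqrt lam * ‖η‖) ≤ R :=
        (mul_le_mul_of_nonneg_left h4 (by positivity)).trans hη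
      have h6 : 2 / Real.sqrt lam * (Real.sqrt lam * ‖η‖) = 2 * ‖η‖ := by field_simp
      linarith
    rw [hk, Set.indicator_of_mem hη, Set.indicator_of_mem hη', hn]
    refine ENNReal.ofReal_le_ofReal (Real.exp_le_exp.2 ?_)
    rw [mul_pow, div_pow, Real.sq_sqrt hlam.le]
    have : lam * (2 ^ 2 / lam * ‖f η‖ ^ 2) = 4 * ‖f η‖ ^ 2 := by field_simp; ring
    rw [this]
    nlinarith [sq_nonneg ‖f η‖]
  · rw [hk, Set.indicator_of_notMem hη]
    exact zero_le

/-- Averaging over a centred ball only increases an exponential tilt. -/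
lemma lintegral_exp_le_lintegral_exp_tilt {q l : Vec d → ℝ} (hq : Continuous q) (hl : Continuous l)
    (hq' : ∀ η, q (-η) = q η) (hl' : ∀ η, l (-η) = -l η) (R : ℝ) :
    ∫⁻ η in Metric.closedBall (0 : Vec d) R, ENNReal.ofReal (Real.exp (-q η))
      ≤ ∫⁻ η in Metric.closedBall (0 : Vec d) R, ENNReal.ofReal (Real.exp (l η - q η)) := by
  have hB : MeasurableSet (Metric.closedBall (0 : Vec d) R) :=
    Metric.isClosed_closedBall.measurableSet
  have hsymm : ∫⁻ η in Metric.closedBall (0 : Vec d) R, ENNReal.ofReal (Real.exp (-l η - q η))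
      = ∫⁻ η in Metric.closedBall (0 : Vec d) R, ENNReal.ofReal (Real.exp (l η - q η)) := by
    rw [← lintegral_indicator hB, ← lintegral_indicator hB, ← lintegral_neg_eq_self]
    refine lintegral_congr fun η => ?_
    by_cases hη : η ∈ Metric.closedBall (0 : Vec d) R
    · have hη' : -η ∈ Metric.closedBall (0 : Vec d) R := by simpa using hη
      rw [Set.indicator_of_mem hη, Set.indicator_of_mem hη', hl', hq', neg_neg]
    · have hη' : -η ∉ Metric.closedBall (0 : Vec d) R := by simpa using hη
      rw [Set.indicator_of_notMem hη, Set.indicator_of_notMem hη']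
  have h2 : 2 * ∫⁻ η in Metric.closedBall (0 : Vec d) R, ENNReal.ofReal (Real.exp (-q η))
      ≤ 2 * ∫⁻ η in Metric.closedBall (0 : Vec d) R, ENNReal.ofReal (Real.exp (l η - q η)) := by
    rw [two_mul (∫⁻ η in _, ENNReal.ofReal (Real.exp (l η - q η)))]
    nth_rewrite 2 [← hsymm]
    rw [← lintegral_add_left (by fun_prop), ← lintegral_const_mul _ (by fun_prop)]
    refine lintegral_mono fun η => ?_
    rw [← ENNReal.ofReal_add (Real.exp_pos _).le (Real.exp_pos _).le,
      show (2 : ENNReal) = ENNReal.ofReal 2 by simp, ← ENNReal.ofReal_mul (by norm_num)]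
    refine ENNReal.ofReal_le_ofReal ?_
    rw [sub_eq_add_neg, sub_eq_add_neg, Real.exp_add, Real.exp_add, ← add_mul]
    refine mul_le_mul_of_nonneg_right ?_ (Real.exp_pos _).le
    have := Real.one_le_cosh (l η)
    rw [Real.cosh_eq] at this
    linarith
  exact (ENNReal.mul_le_mul_iff_right (by norm_num) (by norm_num)).1 h2

/-- Laplace-type lower bound: only the part of the mixture within `R / 2` of a chosen centre `ξ₀` is
kept. The part of the exponent linear in the displacement is odd and is removed by symmetry, leaving
a centred Gaussian integral. -/
lemma exp_mul_ballMass_le_mixture {f : Vec d →ₗ[ℝ] Vec d} (hf : LinearMap.det f ≠ 0)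
    {lam : ℝ} (hlam : 0 < lam) (hle : ∀ x, lam * ‖x‖ ^ 2 ≤ ‖f x‖ ^ 2) {R : ℝ} (u ξ₀ : Vec d)
    (hξ₀ : ‖ξ₀‖ ≤ R / 2) :
    ENNReal.ofReal (Real.exp (⟪ξ₀, u⟫ - ‖f ξ₀‖ ^ 2))
        * (ENNReal.ofReal ((Real.sqrt lam / 2) ^ d * |LinearMap.det f|⁻¹) * ballMass d lam R)
      ≤ ∫⁻ ξ in Metric.closedBall (0 : Vec d) R, ENNReal.ofReal (Real.exp (⟪ξ, u⟫ - ‖f ξ‖ ^ 2)) := by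
  have hfc : Continuous f := f.continuous_of_finiteDimensional
  have hB : ∀ r, MeasurableSet (Metric.closedBall (0 : Vec d) r) := fun r =>
    Metric.isClosed_closedBall.measurableSet
  set l : Vec d → ℝ := fun η => ⟪η, u⟫ - 2 * ⟪f ξ₀, f η⟫ with hl
  have h1 := (ballMass_le_lintegral_ellipsoid hf hlam hle R).trans
    (lintegral_exp_le_lintegral_exp_tilt (q := fun η => ‖f η‖ ^ 2) (l := l) (by fun_prop)
      (by fun_prop) (by simp) (by intro η; simp only [hl, map_neg, inner_neg_left, inner_neg_right]; ring)
      (R / 2))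
  calc _ ≤ ENNReal.ofReal (Real.exp (⟪ξ₀, u⟫ - ‖f ξ₀‖ ^ 2))
        * ∫⁻ η in Metric.closedBall (0 : Vec d) (R / 2),
          ENNReal.ofReal (Real.exp (l η - ‖f η‖ ^ 2)) := by gcongr
    _ = ∫⁻ η, (Metric.closedBall (0 : Vec d) (R / 2)).indicator
          (fun η => ENNReal.ofReal (Real.exp (⟪ξ₀ + η, u⟫ - ‖f (ξ₀ + η)‖ ^ 2))) η := by
        rw [← lintegral_const_mul _ (by fun_prop), lintegral_indicator (hB _)]
        refine lintegral_congr fun η => ?_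
        rw [← ENNReal.ofReal_mul (Real.exp_pos _).le, ← Real.exp_add]
        congr 2
        rw [map_add, norm_add_sq_real, inner_add_left]
        simp only [hl]
        ring
    _ ≤ ∫⁻ η, (Metric.closedBall (0 : Vec d) R).indicator
          (fun ξ => ENNReal.ofReal (Real.exp (⟪ξ, u⟫ - ‖f ξ‖ ^ 2))) (ξ₀ + η) := by
        refine lintegral_mono fun η => ?_
        by_cases hη : η ∈ Metric.closedBall (0 : Vec d) (R / 2)
        · have hη' : ξ₀ + η ∈ Metric.closedBall (0 : Vec d) R := by
            rw [mem_closedBall_zero_iff] at hη ⊢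
            linarith [norm_add_le ξ₀ η]
          rw [Set.indicator_of_mem hη, Set.indicator_of_mem hη']
        · rw [Set.indicator_of_notMem hη]
          exact zero_le
    _ = _ := by
        rw [lintegral_add_left_eq_self, lintegral_indicator (hB _)]

/-- If the dual norm of `u` exceeds the threshold, the mixture of exponential weights is large. -/
lemma exp_mul_ballMass_le_mixture_of_lt {M : Matrix (Fin d) (Fin d) ℝ} (hM : M.PosDef)
    {lam : ℝ} (hlam : 0 < lam) (hle : ∀ x, lam * ‖x‖ ^ 2 ≤ quadForm M x) {R L ρ : ℝ} (hR : 0 < R)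
    (hρ : Real.sqrt lam * R / 2 + 2 / (R * Real.sqrt lam)
      * (L + d * Real.log 2 + (Real.log M.det - d * Real.log lam) / 2) ≤ ρ)
    {u z : Vec d} (hz : ρ * Real.sqrt (quadForm M z) < ⟪z, u⟫) :
    ENNReal.ofReal (Real.exp L) * ballMass d lam R
      ≤ ∫⁻ ξ in Metric.closedBall (0 : Vec d) R,
          ENNReal.ofReal (Real.exp (⟪ξ, u⟫ - quadForm M ξ)) := by
  obtain ⟨f, hf, hdet⟩ := exists_linearMap_norm_sq_eq hM
  have hdet0 : LinearMap.det f ≠ 0 := by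
    intro h
    rw [h] at hdet
    exact hM.det_pos.ne (by simpa using hdet)
  have hs : 0 < Real.sqrt lam := Real.sqrt_pos.2 hlam
  have hz0 : z ≠ 0 := by
    rintro rfl
    simp [quadForm] at hz
  have hq := quadForm_pos hM hz0
  set n := Real.sqrt (quadForm M z) with hn
  have hn0 : 0 < n := Real.sqrt_pos.2 hq
  have hn2 : n ^ 2 = quadForm M z := Real.sq_sqrt hq.le
  -- The centre is the multiple `κ • z` whose `M`-norm is `√λ R / 2`. Because `M ≥ λ I`, it has
  -- Euclidean norm at most `R / 2`.
  set κ := Real.sqrt lam * R / (2 * n) with hκ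
  have hκ0 : 0 < κ := by positivity
  have hnorm : ‖κ • z‖ ≤ R / 2 := by
    have h1 : Real.sqrt lam * ‖z‖ ≤ n := by
      refine le_of_sq_le_sq ?_ hn0.le
      rw [mul_pow, Real.sq_sqrt hlam.le, hn2]
      exact hle z
    rw [norm_smul, Real.norm_of_nonneg hκ0.le, hκ]
    calc Real.sqrt lam * R / (2 * n) * ‖z‖ = R / (2 * n) * (Real.sqrt lam * ‖z‖) := by ring
      _ ≤ R / (2 * n) * n := by gcongr
      _ = R / 2 := by field_simp
  have h := exp_mul_ballMass_le_mixture hdet0 hlam (fun x => by rw [hf]; exact hle x) u (κ • z) hnorm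
  simp only [hf] at h
  refine le_trans ?_ h
  rw [← mul_assoc, ← ENNReal.ofReal_mul (Real.exp_pos _).le]
  gcongr
  have hpos : 0 < (Real.sqrt lam / 2) ^ d * |LinearMap.det f|⁻¹ := by positivity
  rw [← Real.exp_log hpos, ← Real.exp_add, Real.exp_le_exp,
    Real.log_mul (by positivity) (by positivity), Real.log_pow, Real.log_div hs.ne' (by norm_num),
    Real.log_inv, Real.log_abs, Real.log_sqrt hlam.le, ← hf, map_smul, norm_smul, mul_pow, hf,
    Real.norm_of_nonneg hκ0.le, ← hn2, inner_smul_left]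
  rw [← hdet, Real.log_pow] at hρ
  have e1 : κ ^ 2 * n ^ 2 = lam * R ^ 2 / 4 := by
    rw [hκ, div_pow, mul_pow, Real.sq_sqrt hlam.le]
    field_simp
    norm_num
  have e2 : Real.sqrt lam * R / 2 * ρ ≤ κ * ⟪z, u⟫ := by
    calc Real.sqrt lam * R / 2 * ρ = κ * (ρ * n) := by rw [hκ]; field_simp
      _ ≤ κ * ⟪z, u⟫ := by gcongr
  have e3 := mul_le_mul_of_nonneg_left hρ (show 0 ≤ Real.sqrt lam * R / 2 by positivity)
  have e4 : ∀ X, Real.sqrt lam * R / 2 * (Real.sqrt lam * R / 2 + 2 / (R * Real.sqrt lam) * X)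
      = lam * R ^ 2 / 4 + X := by
    intro X
    field_simp
    rw [Real.sq_sqrt hlam.le]
    ring
  rw [e4] at e3
  rw [e1]
  simp only [conj_trivial]
  push_cast at e3
  linarith

end

end GLBandit

namespace GLBandit

noncomputable section

/-! ### Conditional laws of the rewards -/

section Disintegration

variable {Ω E : Type*} {F : ExpFamily}

/-- Disintegration of the joint law of a covariate and a reward drawn from the family. -/
lemma lintegral_of_condLaw [MeasurableSpace Ω] [MeasurableSpace E] {P : Measure Ω}
    [IsProbabilityMeasure P] {Y : Ω → E} {X : E → ℝ} {r : Ω → ℝ} (hY : Measurable Y)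
    (hX : Measurable X) (hr : Measurable r)
    (h : ∀ A : Set E, ∀ s : Set ℝ, MeasurableSet A → MeasurableSet s →
      P (Y ⁻¹' A ∩ r ⁻¹' s) = ∫⁻ ω in Y ⁻¹' A, F.law (X (Y ω)) s ∂P)
    {g : E × ℝ → ENNReal} (hg : Measurable g) :
    ∫⁻ ω, g (Y ω, r ω) ∂P = ∫⁻ ω, ∫⁻ y, g (Y ω, y) ∂F.law (X (Y ω)) ∂P := by
  have hb : Measurable F.b := F.contDiff_b.continuous.measurable
  -- All laws are written as densities against the single law at parameter `0`. The joint law is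
  -- then a density on a product measure, identified on rectangles, and no kernel has to be
  -- constructed.
  set D : E × ℝ → ENNReal := fun p =>
    ENNReal.ofReal (Real.exp (p.2 * (X p.1 - 0) - F.b (X p.1) + F.b 0)) with hD
  have hDm : Measurable D := by fun_prop
  have hmap : P.map (fun ω => (Y ω, r ω)) = ((P.map Y).prod (F.law 0)).withDensity D := by
    have : IsProbabilityMeasure (P.map fun ω => (Y ω, r ω)) :=
      Measure.isProbabilityMeasure_map (by fun_prop)
    refine Measure.ext_prod fun {A s} hA hs => ?_
    rw [Measure.map_apply (by fun_prop) (hA.prod hs), withDensity_apply _ (hA.prod hs),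
      ← Measure.prod_restrict, lintegral_prod _ hDm.aemeasurable]
    have h1 : (fun ω => (Y ω, r ω)) ⁻¹' (A ×ˢ s) = Y ⁻¹' A ∩ r ⁻¹' s := by
      ext ω
      simp
    have h2 : ∀ e, ∫⁻ y in s, D (e, y) ∂F.law 0 = F.law (X e) s := fun e => by
      rw [F.law_eq_withDensity (X e) 0, withDensity_apply _ hs]
    simp_rw [h2]
    have hm : Measurable fun e => F.law (X e) s := by
      simp_rw [← h2]
      exact hDm.lintegral_prod_right'
    rw [h1, h A s hA hs, setLIntegral_map hA hm hY]
  calc ∫⁻ ω, g (Y ω, r ω) ∂P = ∫⁻ p, g p ∂(P.map fun ω => (Y ω, r ω)) :=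
        (lintegral_map hg (by fun_prop)).symm
    _ = ∫⁻ p, (D * g) p ∂((P.map Y).prod (F.law 0)) := by
        rw [hmap, lintegral_withDensity_eq_lintegral_mul _ hDm hg]
    _ = ∫⁻ e, ∫⁻ y, (D * g) (e, y) ∂F.law 0 ∂(P.map Y) :=
        lintegral_prod _ (hDm.mul hg).aemeasurable
    _ = ∫⁻ ω, ∫⁻ y, (D * g) (Y ω, y) ∂F.law 0 ∂P :=
        lintegral_map (hDm.mul hg).lintegral_prod_right' hY
    _ = _ := by
        refine lintegral_congr fun ω => ?_
        rw [F.law_eq_withDensity (X (Y ω)) 0, lintegral_withDensity_eq_lintegral_mul _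
          (by fun_prop) (by fun_prop)]
        rfl

/-- Integrated form of the conditional law, as required on rectangles for the disintegration. -/
lemma measure_inter_of_condExp {G mΩ : MeasurableSpace Ω} {P : Measure Ω} [IsProbabilityMeasure P]
    (hG : G ≤ mΩ) {X r : Ω → ℝ} (hr : Measurable r)
    (h : ∀ s : Set ℝ, MeasurableSet s →
      P⟦r ⁻¹' s | G⟧ =ᵐ[P] fun ω => (F.law (X ω)).real s)
    {A : Set Ω} (hA : MeasurableSet[G] A) {s : Set ℝ} (hs : MeasurableSet s) :
    P (A ∩ r ⁻¹' s) = ∫⁻ ω in A, F.law (X ω) s ∂P := by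
  have hi : Integrable ((r ⁻¹' s).indicator fun _ => (1 : ℝ)) P :=
    (integrable_const 1).indicator (hr hs)
  have h1 := setIntegral_condExp hG hi hA
  have hl : Integrable (fun ω => (F.law (X ω)).real s) P :=
    integrable_condExp.congr (h s hs)
  rw [setIntegral_congr_ae (hG _ hA) ((h s hs).mono fun ω hω _ => hω),
    integral_indicator (hr hs)] at h1
  rw [show (fun ω => F.law (X ω) s) = fun ω => ENNReal.ofReal ((F.law (X ω)).real s) by
      ext ω; simp [measureReal_def],
    ← ofReal_integral_eq_lintegral_ofReal hl.integrableOn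
      (Filter.Eventually.of_forall fun ω => measureReal_nonneg), h1]
  rw [Measure.restrict_restrict (hr hs), Set.inter_comm]
  simp [measureReal_def]

end Disintegration

/-! ### The exponential supermartingale and a self-normalized Bernstein inequality -/

namespace Run

variable {d : ℕ} {Ω : Type u} [mΩ : MeasurableSpace Ω] (B : Run d Ω)

/-- The natural parameter of the reward of round `t`. -/
def natParam (t : ℕ) (ω : Ω) : ℝ := ⟪B.a t ω, B.θ t⟫

/-- The weighted sum of the centred rewards of the rounds before `t`. -/
def noise (w : ℕ → ℝ) (t : ℕ) (ω : Ω) : Vec d :=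
  ∑ s ∈ Finset.Icc 1 (t - 1),
    (w s * (B.r (s + 1) ω - B.family.mean (B.natParam s ω))) • B.a s ω

/-- The regularized conditional covariance of `noise`. -/
def noiseGram (w : ℕ → ℝ) (lam : ℝ) (t : ℕ) (ω : Ω) : Matrix (Fin d) (Fin d) ℝ :=
  gram (Finset.Icc 1 (t - 1)) (fun s => w s ^ 2 * deriv B.family.mean (B.natParam s ω))
    (fun s => B.a s ω) lam

/-- The contribution of round `s` to the exponent of the supermartingale. -/
def logIncrement (w : ℕ → ℝ) (ξ : Vec d) (s : ℕ) (ω : Ω) : ℝ :=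
  w s * ⟪B.a s ω, ξ⟫ * (B.r (s + 1) ω - B.family.mean (B.natParam s ω))
    - (w s * ⟪B.a s ω, ξ⟫) ^ 2 * deriv B.family.mean (B.natParam s ω)

variable {B} {P : Measure Ω} {T : ℕ} {S m : ℝ} {k : ℝ≥0}

lemma inner_noise_sub_quadForm (w : ℕ → ℝ) (lam : ℝ) (t : ℕ) (ω : Ω) (ξ : Vec d) :
    ⟪ξ, B.noise w t ω⟫ - quadForm (B.noiseGram w lam t ω) ξ
      = ∑ s ∈ Finset.Icc 1 (t - 1), B.logIncrement w ξ s ω - lam * ‖ξ‖ ^ 2 := by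
  rw [noiseGram, quadForm_gram, noise, inner_sum, ← sub_sub, ← Finset.sum_sub_distrib]
  congr 1
  refine Finset.sum_congr rfl fun s _ => ?_
  rw [inner_smul_right, real_inner_comm, logIncrement]
  ring

/-- The reward of round `1` lies in `[0, m]` almost surely, so some law of the family gives the
complement mass zero; by equivalence of null sets so does `ν`. Hence `μ` takes values in `[0, m]` at
every real argument, also at parameters that never occur. -/
lemma IsInteraction.ae_reference [IsProbabilityMeasure P]
    (hB : B.IsInteraction P T) (hT : 1 ≤ T)
    (hS : B.StandingAssumptions P T S m k) : B.family.ν (Set.Icc 0 m)ᶜ = 0 := by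
  have hr : Measurable (B.r 2) := (hB.measurable_r 1 le_rfl hT).mono (B.ℱ.le _) le_rfl
  have h := hB.condLaw 1 le_rfl hT (Set.Icc 0 m)ᶜ measurableSet_Icc.compl
  have h0 : (B.r (1 + 1) ⁻¹' (Set.Icc 0 m)ᶜ).indicator (fun _ => (1 : ℝ)) =ᵐ[P] 0 := by
    filter_upwards [hS.reward_mem 1 le_rfl hT] with ω hω
    rw [Set.indicator_of_notMem]
    · rfl
    · simpa using hω
  have h1 := (condExp_congr_ae (m := B.ℱ 1) h0).symm.trans h
  rw [condExp_zero] at h1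
  obtain ⟨ω, hω⟩ := h1.exists
  simp only [Pi.zero_apply] at hω
  rw [← B.family.law_eq_zero_iff ⟪B.a 1 ω, B.θ 1⟫]
  exact (measureReal_eq_zero_iff).1 hω.symm

lemma IsInteraction.measurable_action (hB : B.IsInteraction P T) {s : ℕ} (h1 : 1 ≤ s)
    (hs : s ≤ T) : Measurable (B.a s) := (hB.measurable_a s h1 hs).mono (B.ℱ.le _) le_rfl

lemma IsInteraction.measurable_reward (hB : B.IsInteraction P T) {s : ℕ} (h1 : 1 ≤ s)
    (hs : s ≤ T) : Measurable (B.r (s + 1)) := (hB.measurable_r s h1 hs).mono (B.ℱ.le _) le_rfl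

lemma StandingAssumptions.measurable_mean (hS : B.StandingAssumptions P T S m k) :
    Measurable B.family.mean := hS.mean_contDiff.continuous.measurable

lemma IsInteraction.measurable_logIncrement (hB : B.IsInteraction P T)
    (hS : B.StandingAssumptions P T S m k) (w : ℕ → ℝ) (ξ : Vec d) {s n : ℕ} (h1 : 1 ≤ s)
    (hs : s ≤ T) (hn : s < n) : Measurable[B.ℱ n] (B.logIncrement w ξ s) := by
  have ha : Measurable[B.ℱ n] (B.a s) := (hB.measurable_a s h1 hs).mono (B.ℱ.mono hn.le) le_rfl
  have hr : Measurable[B.ℱ n] (B.r (s + 1)) :=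
    (hB.measurable_r s h1 hs).mono (B.ℱ.mono hn) le_rfl
  have hμ := hS.measurable_mean
  have hμ' : Measurable (deriv B.family.mean) := measurable_deriv _
  unfold logIncrement natParam
  fun_prop

/-- The exponential weights of the noise have expectation at most one. -/
lemma IsInteraction.lintegral_exp_sum_logIncrement_le_one [IsProbabilityMeasure P]
    (hB : B.IsInteraction P T) (hm : 0 < m)
    (hS : B.StandingAssumptions P T S m k) {w : ℕ → ℝ} (hw0 : ∀ s, 0 ≤ w s) (hw1 : ∀ s, w s ≤ 1)
    {ξ : Vec d} (hξ : ‖ξ‖ ≤ 1 / m) {n : ℕ} (hn : n ≤ T) :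
    ∫⁻ ω, ENNReal.ofReal (Real.exp (∑ s ∈ Finset.Icc 1 n, B.logIncrement w ξ s ω)) ∂P ≤ 1 := by
  induction n with
  | zero => simp
  | succ n ih =>
    have hn1 : 1 ≤ n + 1 := by omega
    have hν := hB.ae_reference (hn1.trans hn) hS
    have hμ := hS.measurable_mean
    have hμ' : Measurable (deriv B.family.mean) := measurable_deriv _
    have hf : Measurable[B.ℱ (n + 1)] fun ω => ∑ s ∈ Finset.Icc 1 n, B.logIncrement w ξ s ω := by
      refine Finset.measurable_fun_sum _ fun s hs => ?_
      rw [Finset.mem_Icc] at hs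
      exact hB.measurable_logIncrement hS w ξ hs.1 (by omega) (by omega)
    have ha := hB.measurable_a (n + 1) hn1 hn
    -- The past influences the next increment only through these three real numbers, so it is enough
    -- to disintegrate over `ℝ × ℝ × ℝ`.
    have hY : Measurable[B.ℱ (n + 1)] fun ω => ((∑ s ∈ Finset.Icc 1 n, B.logIncrement w ξ s ω,
        w (n + 1) * ⟪B.a (n + 1) ω, ξ⟫, B.natParam (n + 1) ω) : ℝ × ℝ × ℝ) := by
      refine hf.prodMk (Measurable.prodMk ?_ ?_)
      · fun_prop
      · unfold natParam
        fun_prop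
    have key := lintegral_of_condLaw (P := P) (F := B.family)
      (X := fun e : ℝ × ℝ × ℝ => e.2.2) (hY.mono (B.ℱ.le _) le_rfl) (by fun_prop)
      (hB.measurable_reward hn1 hn)
      (fun A s hA hs => measure_inter_of_condExp (B.ℱ.le _) (hB.measurable_reward hn1 hn)
        (hB.condLaw (n + 1) hn1 hn) (hY hA) hs)
      (g := fun p : (ℝ × ℝ × ℝ) × ℝ => ENNReal.ofReal (Real.exp p.1.1)
        * ENNReal.ofReal (Real.exp (p.1.2.1 * (p.2 - B.family.mean p.1.2.2)
            - p.1.2.1 ^ 2 * deriv B.family.mean p.1.2.2))) (by fun_prop)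
    calc ∫⁻ ω, ENNReal.ofReal (Real.exp (∑ s ∈ Finset.Icc 1 (n + 1), B.logIncrement w ξ s ω)) ∂P
        = _ := by
          refine lintegral_congr fun ω => ?_
          rw [Finset.sum_Icc_succ_top hn1, Real.exp_add, ENNReal.ofReal_mul (Real.exp_pos _).le]
          rfl
      _ = _ := key
      _ ≤ ∫⁻ ω, ENNReal.ofReal (Real.exp (∑ s ∈ Finset.Icc 1 n, B.logIncrement w ξ s ω)) ∂P := by
          refine lintegral_mono fun ω => ?_
          dsimp only
          rw [lintegral_const_mul' _ _ ENNReal.ofReal_ne_top]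
          refine mul_le_of_le_one_right' (ExpFamily.lintegral_exp_centred_le_one hν _ _ ?_)
          have h1 : |⟪B.a (n + 1) ω, ξ⟫| ≤ 1 / m := by
            refine (abs_real_inner_le_norm _ _).trans ?_
            have := hS.norm_action_le (n + 1) hn1 hn ω _ (hB.mem_A (n + 1) hn1 hn ω)
            calc ‖B.a (n + 1) ω‖ * ‖ξ‖ ≤ 1 * (1 / m) := by gcongr
              _ = 1 / m := one_mul _
          rw [abs_mul, abs_of_nonneg (hw0 _)]
          calc w (n + 1) * |⟪B.a (n + 1) ω, ξ⟫| * m ≤ 1 * (1 / m) * m := by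
                gcongr
                exact hw1 _
            _ = 1 := by field_simp
      _ ≤ 1 := ih (by omega)

/-- Self-normalized Bernstein inequality at a fixed round. -/
lemma IsInteraction.measure_noise_le [IsProbabilityMeasure P]
    (hB : B.IsInteraction P T) (hm : 0 < m)
    (hS : B.StandingAssumptions P T S m k) {w : ℕ → ℝ} (hw0 : ∀ s, 0 ≤ w s) (hw1 : ∀ s, w s ≤ 1)
    {lam L ρ : ℝ} (hlam : 0 < lam) {t : ℕ} (ht : t ≤ T)
    (hρ : ∀ ω, Real.sqrt lam / (2 * m) + 2 * m / Real.sqrt lam * (L + d * Real.log 2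
      + (Real.log (B.noiseGram w lam t ω).det - d * Real.log lam) / 2) ≤ ρ) :
    P {ω | ∃ z, ρ * Real.sqrt (quadForm (B.noiseGram w lam t ω) z) < ⟪z, B.noise w t ω⟫}
      ≤ ENNReal.ofReal (Real.exp (-L)) := by
  have hR : (0 : ℝ) < 1 / m := by positivity
  set N := ballMass d lam (1 / m) with hN
  have hN0 : N ≠ 0 := ballMass_ne_zero d lam hR
  have hNt : N ≠ ⊤ := ballMass_ne_top d hlam.le _
  have hμ := hS.measurable_mean
  have hμ' : Measurable (deriv B.family.mean) := measurable_deriv _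
  have hsc := deriv_nonneg_of_selfConcordant hS.selfConcordant
  have hpd : ∀ ω, (B.noiseGram w lam t ω).PosDef := fun ω =>
    gram_posDef _ (fun s _ => mul_nonneg (sq_nonneg _) (hsc _)) hlam
  have hmeas : Measurable fun p : Ω × Vec d =>
      ENNReal.ofReal (Real.exp (⟪p.2, B.noise w t p.1⟫ - quadForm (B.noiseGram w lam t p.1) p.2)) := by
    simp_rw [inner_noise_sub_quadForm]
    have h1 : Measurable fun p : Ω × Vec d =>
        ∑ s ∈ Finset.Icc 1 (t - 1), B.logIncrement w p.2 s p.1 := by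
      refine Finset.measurable_fun_sum _ fun s hs => ?_
      rw [Finset.mem_Icc] at hs
      have ha := hB.measurable_action hs.1 (show s ≤ T by omega)
      have hr := hB.measurable_reward hs.1 (show s ≤ T by omega)
      unfold logIncrement natParam
      fun_prop
    fun_prop
  set mix : Ω → ENNReal := fun ω => ∫⁻ ξ in Metric.closedBall (0 : Vec d) (1 / m),
    ENNReal.ofReal (Real.exp (⟪ξ, B.noise w t ω⟫ - quadForm (B.noiseGram w lam t ω) ξ)) with hmix
  have hmixm : Measurable mix := hmeas.lintegral_prod_right'
  have hint : ∫⁻ ω, mix ω ∂P ≤ N := by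
    -- By Tonelli, each fixed `ξ` in the ball contributes an expectation of at most one, times its
    -- Gaussian weight.
    rw [hmix, lintegral_lintegral_swap hmeas.aemeasurable, hN, ballMass]
    refine setLIntegral_mono' Metric.isClosed_closedBall.measurableSet fun ξ hξ => ?_
    rw [mem_closedBall_zero_iff] at hξ
    simp_rw [inner_noise_sub_quadForm, sub_eq_neg_add, Real.exp_add,
      ENNReal.ofReal_mul (Real.exp_pos _).le]
    rw [lintegral_const_mul' _ _ ENNReal.ofReal_ne_top]
    exact mul_le_of_le_one_right'
      (hB.lintegral_exp_sum_logIncrement_le_one hm hS hw0 hw1 hξ (by omega))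
  -- One superlevel set of the mixture contains the failures for all directions `z` at once. The
  -- left-hand set need not be shown measurable.
  have hsub : {ω | ∃ z, ρ * Real.sqrt (quadForm (B.noiseGram w lam t ω) z) < ⟪z, B.noise w t ω⟫}
      ⊆ {ω | ENNReal.ofReal (Real.exp L) * N ≤ mix ω} := by
    rintro ω ⟨z, hz⟩
    refine exp_mul_ballMass_le_mixture_of_lt (hpd ω) hlam (fun x => ?_) hR ?_ hz
    · rw [noiseGram, quadForm_gram]
      exact le_add_of_nonneg_left (Finset.sum_nonneg fun s _ =>
        mul_nonneg (mul_nonneg (sq_nonneg _) (hsc _)) (sq_nonneg _))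
    · convert hρ ω using 2
      · field_simp
      · field_simp
  have hpos : ENNReal.ofReal (Real.exp L) ≠ 0 := by simp [Real.exp_pos]
  calc _ ≤ P {ω | ENNReal.ofReal (Real.exp L) * N ≤ mix ω} := measure_mono hsub
    _ ≤ (∫⁻ ω, mix ω ∂P) / (ENNReal.ofReal (Real.exp L) * N) :=
        meas_ge_le_lintegral_div hmixm.aemeasurable (mul_ne_zero hpos hN0)
          (ENNReal.mul_ne_top ENNReal.ofReal_ne_top hNt)
    _ ≤ N / (ENNReal.ofReal (Real.exp L) * N) := by gcongr
    _ = ENNReal.ofReal (Real.exp (-L)) := by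
        rw [Real.exp_neg, ENNReal.ofReal_inv_of_pos (Real.exp_pos _), ← one_mul N, ← mul_assoc,
          mul_one, ENNReal.mul_div_mul_right _ _ hN0 hNt, one_div]

end Run

end

end GLBandit

namespace GLBandit

noncomputable section

/-! ### Windowed discount weights -/

section Weights

lemma sum_Icc_lag (f : ℕ → ℝ) (t : ℕ) :
    ∑ s ∈ Finset.Icc 1 (t - 1), f (t - 1 - s) = ∑ j ∈ Finset.range (t - 1), f j := by
  refine Finset.sum_nbij' (fun s => t - 1 - s) (fun j => t - 1 - j) ?_ ?_ ?_ ?_ ?_ <;>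
    intro s hs <;> simp only [Finset.mem_Icc, Finset.mem_range] at * <;> omega

lemma sum_range_pow_le {γ : ℝ} (h0 : 0 ≤ γ) (h1 : γ < 1) (n : ℕ) :
    ∑ j ∈ Finset.range n, γ ^ j ≤ 1 / (1 - γ) := by
  rw [geom_sum_eq h1.ne, ← neg_div_neg_eq, neg_sub, neg_sub]
  have := pow_nonneg h0 n
  have h2 : 0 < 1 - γ := by linarith
  gcongr
  linarith

/-- A truncation of the discount weights to a window of length about `log T / (1 - γ)`, the last
weight being chosen so that both the squared mass and the lost mass are exactly as if the window
length were the real number `log T / log (1 / γ)`. -/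
lemma exists_window_weights {T : ℕ} (hT : 1 ≤ T) {γ : ℝ} (h0 : 0 < γ) (h1 : γ < 1) :
    ∃ (D : ℕ) (w : ℕ → ℝ), (∀ j, 0 ≤ w j) ∧ (∀ j, w j ≤ γ ^ j) ∧ (∀ j, D < j → w j = 0) ∧
      (∀ n, ∑ j ∈ Finset.range n, w j ^ 2 ≤ (1 - 1 / (T : ℝ) ^ 2) / (1 - γ ^ 2)) ∧
      (∀ n, ∑ j ∈ Finset.range n, (γ ^ j - w j) ≤ 1 / (T * (1 - γ))) ∧
      (D : ℝ) ≤ Real.log T / (1 - γ) := by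
  have hT0 : (0 : ℝ) < T := by exact_mod_cast hT
  have hT1 : (1 : ℝ) ≤ T := by exact_mod_cast hT
  set e : ℝ := 1 / T with he
  have he0 : 0 < e := by positivity
  have he1 : e ≤ 1 := by rw [he, div_le_one hT0]; exact hT1
  have hγ : 0 < 1 - γ := by linarith
  have hγ2 : 0 < 1 - γ ^ 2 := by nlinarith
  have hex : ∃ n, γ ^ n < e := exists_pow_lt_of_lt_one he0 h1
  -- `D` is the last lag with `γ ^ D ≥ 1/T`.
  obtain ⟨D, hD⟩ : ∃ D, Nat.find hex = D + 1 := by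
    refine Nat.exists_eq_succ_of_ne_zero fun h => ?_
    have := Nat.find_spec hex
    rw [h, pow_zero] at this
    linarith
  have hlt : γ ^ (D + 1) < e := hD ▸ Nat.find_spec hex
  have hge : e ≤ γ ^ D := not_lt.1 (Nat.find_min hex (by omega))
  set g := γ ^ D with hg
  have hgg : g * γ < e := by rwa [pow_succ] at hlt
  have hg1 : g ≤ 1 := pow_le_one₀ h0.le h1.le
  -- This weight at lag `D` makes the total kept mass exactly `(1 - 1/T) / (1 - γ)`. Both `v ≤ γ ^
  -- D` and the bound on `v²` below amount to `γ ^ (D + 1) ≤ 1/T`.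
  set v := (g - e) / (1 - γ) with hv
  have hv0 : 0 ≤ v := div_nonneg (by linarith) hγ.le
  have hvg : v ≤ g := by
    rw [hv, div_le_iff₀ hγ]
    linarith
  set w : ℕ → ℝ := fun j => if j < D then γ ^ j else if j = D then v else 0 with hw
  have hwlt : ∀ j, j < D → w j = γ ^ j := fun j hj => by simp [hw, hj]
  have hwD : w D = v := by simp [hw]
  have hwgt : ∀ j, D < j → w j = 0 := fun j hj => by
    simp [hw, not_lt.2 hj.le, hj.ne']
  have hw0 : ∀ j, 0 ≤ w j := fun j => by
    rcases lt_trichotomy j D with h | h | h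
    · rw [hwlt j h]; positivity
    · rw [h, hwD]; exact hv0
    · rw [hwgt j h]
  have hwle : ∀ j, w j ≤ γ ^ j := fun j => by
    rcases lt_trichotomy j D with h | h | h
    · rw [hwlt j h]
    · rw [h, hwD]; exact hvg
    · rw [hwgt j h]; positivity
  refine ⟨D, w, hw0, hwle, hwgt, fun n => ?_, fun n => ?_, ?_⟩
  · have hsub : ∑ j ∈ Finset.range n, w j ^ 2 ≤ ∑ j ∈ Finset.range (D + 1), w j ^ 2 := by
      rw [← Finset.sum_subset (s₁ := Finset.range n ∩ Finset.range (D + 1))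
        Finset.inter_subset_left]
      · exact Finset.sum_le_sum_of_subset_of_nonneg Finset.inter_subset_right
          fun j _ _ => sq_nonneg _
      · intro j hj hj'
        simp only [Finset.mem_inter, Finset.mem_range, not_and, not_lt] at hj hj'
        rw [hwgt j (hj' hj)]
        simp
    refine hsub.trans ?_
    rw [Finset.sum_range_succ, hwD, Finset.sum_congr rfl (g := fun j => (γ ^ 2) ^ j)
      (fun j hj => by rw [hwlt j (Finset.mem_range.1 hj), ← pow_mul, ← pow_mul, mul_comm]),
      geom_sum_eq (by nlinarith), ← neg_div_neg_eq, neg_sub, neg_sub, ← pow_mul, mul_comm 2 D,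
      pow_mul, ← hg, show 1 / (T : ℝ) ^ 2 = e ^ 2 by rw [he]; ring]
    have hv2 : v ^ 2 ≤ (g ^ 2 - e ^ 2) / (1 - γ ^ 2) := by
      rw [hv, div_pow, div_le_div_iff₀ (by positivity) hγ2]
      have h2 : (g - e) * (1 + γ) ≤ (g + e) * (1 - γ) := by nlinarith
      have h3 : 0 ≤ (g - e) * (1 - γ) := mul_nonneg (by linarith) hγ.le
      nlinarith [mul_le_mul_of_nonneg_left h2 h3]
    have : (1 - e ^ 2) / (1 - γ ^ 2) = (1 - g ^ 2) / (1 - γ ^ 2) + (g ^ 2 - e ^ 2) / (1 - γ ^ 2) := by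
      rw [← add_div]
      ring
    linarith
  · have hsub : ∑ j ∈ Finset.range n, (γ ^ j - w j)
        ≤ ∑ j ∈ Finset.range (D + 1 + n), (γ ^ j - w j) :=
      Finset.sum_le_sum_of_subset_of_nonneg (Finset.range_mono (by omega))
        fun j _ _ => sub_nonneg.2 (hwle j)
    refine hsub.trans ?_
    have hws : ∑ j ∈ Finset.range (D + 1 + n), w j = (1 - e) / (1 - γ) := by
      rw [Finset.sum_range_add, Finset.sum_range_succ, hwD, Finset.sum_congr rfl (g := fun j => γ ^ j)
        (fun j hj => hwlt j (Finset.mem_range.1 hj)), geom_sum_eq h1.ne, ← neg_div_neg_eq, neg_sub,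
        neg_sub, Finset.sum_eq_zero (s := Finset.range n) (fun j _ => hwgt _ (by omega)), ← hg, hv,
        add_zero, ← add_div]
      ring
    rw [Finset.sum_sub_distrib, hws]
    have h2 := sum_range_pow_le h0.le h1 (D + 1 + n)
    have h3 : 1 / (T * (1 - γ)) = 1 / (1 - γ) - (1 - e) / (1 - γ) := by
      rw [← sub_div, he]
      field_simp
      ring
    linarith
  · rw [le_div_iff₀ hγ]
    have h2 := Real.log_le_log he0 hge
    rw [he, hg, Real.log_pow, one_div, Real.log_inv] at h2
    have h3 := Real.log_le_sub_one_of_pos h0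
    have h4 : (0 : ℝ) ≤ D := by positivity
    nlinarith

end Weights

/-! ### Deviation of the penalized maximum-likelihood estimator -/

section Prediction

lemma le_of_sq_le_mul_add {s b c : ℝ} (hb : 0 ≤ b) (hc : 0 ≤ c) (h : s ^ 2 ≤ b * s + c) :
    s ≤ b + Real.sqrt c := by
  by_contra hlt
  rw [not_le] at hlt
  have h1 := Real.sqrt_nonneg c
  have h2 := Real.sq_sqrt hc
  nlinarith

lemma rpow_three_halves {x : ℝ} (hx : 0 ≤ x) : x ^ (3 / 2 : ℝ) = x * Real.sqrt x := by
  rw [show (3 / 2 : ℝ) = 1 + 1 / 2 by norm_num, Real.rpow_add' hx (by norm_num), Real.rpow_one,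
    Real.sqrt_eq_rpow]

/-- Solution of the implicit inequality for the estimation error. -/
lemma sqrt_one_add_mul_le {lam ρ s n u : ℝ} (hlam : 0 < lam) (hρ : 0 ≤ ρ) (hs : 0 ≤ s)
    (hn : 0 ≤ n) (hu : 0 ≤ u) (hnu : Real.sqrt lam * n ≤ u)
    (h : u ^ 2 ≤ ρ * (Real.sqrt (1 + n) * u) + n * (lam * s)) :
    Real.sqrt (1 + n) * u
      ≤ Real.sqrt lam * (1 + s + Real.sqrt ((1 + s) / lam) * ρ + (ρ / Real.sqrt lam) ^ 2)
          ^ (3 / 2 : ℝ) := by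
  have hl : 0 < Real.sqrt lam := Real.sqrt_pos.2 hlam
  have hl2 : Real.sqrt lam ^ 2 = lam := Real.sq_sqrt hlam.le
  set b := ρ / Real.sqrt lam with hb
  have hb0 : 0 ≤ b := div_nonneg hρ hl.le
  have hρb : ρ = b * Real.sqrt lam := by rw [hb]; field_simp
  set q := Real.sqrt (1 + s) with hq
  have hq0 : 0 ≤ q := Real.sqrt_nonneg _
  have hq2 : q ^ 2 = 1 + s := Real.sq_sqrt (by linarith)
  have hW : 1 + s + Real.sqrt ((1 + s) / lam) * ρ + b ^ 2 = q ^ 2 + q * b + b ^ 2 := by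
    rw [Real.sqrt_div (by linarith), hq2, ← hq, hb]
    ring
  rw [hW]
  set W := q ^ 2 + q * b + b ^ 2 with hWdef
  have hW0 : 0 ≤ W := by positivity
  set v := Real.sqrt (1 + n) with hv
  have hv0 : 0 ≤ v := Real.sqrt_nonneg _
  have hv2 : v ^ 2 = 1 + n := Real.sq_sqrt (by linarith)
  -- Division by `u`, after spending `√λ n ≤ u` on the bias. The same relation then gives `n ≤ b v +
  -- s`, a quadratic inequality for `v = √(1 + n)`, hence `v ≤ b + √(1 + s)`.
  have hu1 : u ≤ Real.sqrt lam * (b * v + s) := by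
    rcases hu.eq_or_lt with h0 | h0
    · rw [← h0]; positivity
    · have h3 : n * (lam * s) ≤ Real.sqrt lam * s * u := by
        calc n * (lam * s) = Real.sqrt lam * s * (Real.sqrt lam * n) := by
              rw [← hl2, Real.sqrt_sq hl.le]; ring
          _ ≤ _ := by gcongr
      refine le_of_mul_le_mul_right ?_ h0
      calc u * u = u ^ 2 := by ring
        _ ≤ ρ * (v * u) + Real.sqrt lam * s * u := by linarith
        _ = _ := by rw [hρb]; ring
  have hn1 : n ≤ b * v + s := le_of_mul_le_mul_left (hnu.trans hu1) hl
  have hvle : v ≤ b + q := by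
    refine le_of_sq_le_mul_add hb0 (by linarith) ?_
    linarith
  have hbv : b * v + s ≤ W := by
    have := mul_le_mul_of_nonneg_left hvle hb0
    nlinarith
  have hvW : v ^ 2 ≤ W := by
    have := mul_le_mul_of_nonneg_left hvle hb0
    nlinarith
  have hvW' : v ≤ Real.sqrt W := Real.le_sqrt_of_sq_le hvW
  rw [rpow_three_halves hW0]
  calc v * u ≤ Real.sqrt W * (Real.sqrt lam * W) := by
        gcongr
        exact hu1.trans (by gcongr)
    _ = _ := by ring

variable {d : ℕ}

/-- Deviation of a discounted penalized maximum-likelihood estimator from a parameter, measured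
in the discounted information norm at that parameter. -/
lemma sqrt_information_le {μ : ℝ → ℝ} (hμ : Differentiable ℝ μ) (hd : Differentiable ℝ (deriv μ))
    (hsc : ∀ x, |deriv (deriv μ) x| ≤ deriv μ x) {I : Finset ℕ} {p w r : ℕ → ℝ} {a : ℕ → Vec d}
    {θ θhat : Vec d} {lam ρ S sbar m : ℝ} (hlam : 0 < lam) (hρ : 0 ≤ ρ)
    (hp : ∀ i ∈ I, p i ≤ 1) (hw0 : ∀ i ∈ I, 0 ≤ w i) (hw : ∀ i ∈ I, w i ≤ p i)
    (ha : ∀ i ∈ I, ‖a i‖ ≤ 1) (hθ : ‖θ‖ ≤ S) (hr : ∀ i ∈ I, |r i - μ ⟪a i, θ⟫| ≤ m)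
    (hbias : m * ∑ i ∈ I, (p i - w i) + lam * S ≤ lam * sbar)
    (hfoc : ∑ i ∈ I, p i * (r i - μ ⟪a i, θhat⟫) * ⟪a i, θhat - θ⟫ = lam * ⟪θhat, θhat - θ⟫)
    (hnoise : ∑ i ∈ I, w i * (r i - μ ⟪a i, θ⟫) * ⟪a i, θhat - θ⟫
      ≤ ρ * Real.sqrt (∑ i ∈ I, w i ^ 2 * deriv μ ⟪a i, θ⟫ * ⟪a i, θhat - θ⟫ ^ 2
          + lam * ‖θhat - θ‖ ^ 2)) :
    Real.sqrt (∑ i ∈ I, p i * deriv μ ⟪a i, θ⟫ * ⟪a i, θhat - θ⟫ ^ 2 + lam * ‖θhat - θ‖ ^ 2)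
      ≤ Real.sqrt lam * (1 + sbar + Real.sqrt ((1 + sbar) / lam) * ρ + (ρ / Real.sqrt lam) ^ 2)
          ^ (3 / 2 : ℝ) := by
  set z := θhat - θ with hz
  set n := ‖z‖ with hn
  have hn0 : 0 ≤ n := norm_nonneg _
  have hμ' := deriv_nonneg_of_selfConcordant hsc
  have hp0 : ∀ i ∈ I, 0 ≤ p i := fun i hi => (hw0 i hi).trans (hw i hi)
  have haz : ∀ i ∈ I, |⟪a i, z⟫| ≤ n := fun i hi =>
    (abs_real_inner_le_norm _ _).trans (mul_le_of_le_one_left hn0 (ha i hi))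
  have hdiff : ∀ i, ⟪a i, θhat⟫ - ⟪a i, θ⟫ = ⟪a i, z⟫ := fun i => by rw [hz, inner_sub_right]
  set u2 := ∑ i ∈ I, p i * ((μ ⟪a i, θhat⟫ - μ ⟪a i, θ⟫) * ⟪a i, z⟫) + lam * n ^ 2 with hu2
  set A2 := ∑ i ∈ I, p i * deriv μ ⟪a i, θ⟫ * ⟪a i, z⟫ ^ 2 + lam * n ^ 2 with hA2
  -- Self-concordance along each action, with `|⟪a i, z⟫| ≤ n`: information at the true parameter is
  -- at most `1 + n` times the secant form `u2`.
  have hterm : ∀ i ∈ I, deriv μ ⟪a i, θ⟫ * ⟪a i, z⟫ ^ 2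
      ≤ (1 + n) * ((μ ⟪a i, θhat⟫ - μ ⟪a i, θ⟫) * ⟪a i, z⟫) := fun i hi => by
    have h1 := selfConcordant_sub_mul_sub hμ hd hsc ⟪a i, θ⟫ ⟪a i, θhat⟫
    rw [hdiff] at h1
    rw [div_le_iff₀ (by positivity)] at h1
    have h2 : 0 ≤ (μ ⟪a i, θhat⟫ - μ ⟪a i, θ⟫) * ⟪a i, z⟫ := by
      by_contra hneg
      rw [not_le] at hneg
      have h3 := mul_nonneg (hμ' ⟪a i, θ⟫) (sq_nonneg ⟪a i, z⟫)
      have h4 : 0 < 1 + |⟪a i, z⟫| := by positivity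
      nlinarith
    have h5 := haz i hi
    nlinarith
  have hpos : ∀ i ∈ I, 0 ≤ (μ ⟪a i, θhat⟫ - μ ⟪a i, θ⟫) * ⟪a i, z⟫ := fun i hi => by
    have h3 := mul_nonneg (hμ' ⟪a i, θ⟫) (sq_nonneg ⟪a i, z⟫)
    exact nonneg_of_mul_nonneg_right (h3.trans (hterm i hi)) (by linarith)
  have hu20 : lam * n ^ 2 ≤ u2 := le_add_of_nonneg_left
    (Finset.sum_nonneg fun i hi => mul_nonneg (hp0 i hi) (hpos i hi))
  have hu2nn : 0 ≤ u2 := le_trans (by positivity) hu20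
  have hAu : A2 ≤ (1 + n) * u2 := by
    rw [hA2, hu2, mul_add, Finset.mul_sum]
    refine add_le_add (Finset.sum_le_sum fun i hi => ?_) ?_
    · have := mul_le_mul_of_nonneg_left (hterm i hi) (hp0 i hi)
      linarith
    · have : 0 ≤ lam * n ^ 2 := by positivity
      nlinarith
  set u := Real.sqrt u2 with hu
  have hu0 : 0 ≤ u := Real.sqrt_nonneg _
  have huu : u ^ 2 = u2 := Real.sq_sqrt hu2nn
  have hAsqrt : Real.sqrt A2 ≤ Real.sqrt (1 + n) * u := by
    rw [hu, ← Real.sqrt_mul (by linarith)]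
    exact Real.sqrt_le_sqrt hAu
  have hnu : Real.sqrt lam * n ≤ u := by
    refine Real.le_sqrt_of_sq_le ?_
    rw [mul_pow, Real.sq_sqrt hlam.le]
    exact hu20
  have hbar : 0 ≤ sbar := by
    have h1 : 0 ≤ S := (norm_nonneg _).trans hθ
    have h2 : 0 ≤ m * ∑ i ∈ I, (p i - w i) := by
      rw [Finset.mul_sum]
      exact Finset.sum_nonneg fun i hi =>
        mul_nonneg ((abs_nonneg _).trans (hr i hi)) (sub_nonneg.2 (hw i hi))
    have h3 : 0 ≤ lam * sbar := by nlinarith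
    exact nonneg_of_mul_nonneg_right h3 hlam
  -- Optimality replaces the predictions at `θhat` by the rewards. Splitting `p = w + (p - w)`
  -- separates windowed noise from the bias, to which the penalty adds `-λ ⟪θ, z⟫`.
  have hsplit : u2 = ∑ i ∈ I, w i * (r i - μ ⟪a i, θ⟫) * ⟪a i, z⟫
      + (∑ i ∈ I, (p i - w i) * (r i - μ ⟪a i, θ⟫) * ⟪a i, z⟫ - lam * ⟪θ, z⟫) := by
    have h1 : lam * n ^ 2 = lam * ⟪θhat, z⟫ - lam * ⟪θ, z⟫ := by
      rw [← mul_sub, ← inner_sub_left, ← hz, real_inner_self_eq_norm_sq]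
    rw [hu2, h1, ← hfoc, ← add_sub_assoc, ← add_sub_assoc, ← Finset.sum_add_distrib,
      ← Finset.sum_add_distrib]
    congr 1
    refine Finset.sum_congr rfl fun i _ => ?_
    ring
  have hbias' : ∑ i ∈ I, (p i - w i) * (r i - μ ⟪a i, θ⟫) * ⟪a i, z⟫ - lam * ⟪θ, z⟫
      ≤ n * (lam * sbar) := by
    have h1 : ∑ i ∈ I, (p i - w i) * (r i - μ ⟪a i, θ⟫) * ⟪a i, z⟫
        ≤ ∑ i ∈ I, (p i - w i) * (m * n) := by
      refine Finset.sum_le_sum fun i hi => ?_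
      rw [mul_assoc]
      refine mul_le_mul_of_nonneg_left ?_ (sub_nonneg.2 (hw i hi))
      refine (le_abs_self _).trans ?_
      rw [abs_mul]
      exact mul_le_mul (hr i hi) (haz i hi) (abs_nonneg _) ((abs_nonneg _).trans (hr i hi))
    have h2 : -(lam * ⟪θ, z⟫) ≤ lam * S * n := by
      have h3 := (abs_le.1 (abs_real_inner_le_norm θ z)).1
      have h4 : ‖θ‖ * n ≤ S * n := by gcongr
      nlinarith
    rw [← Finset.sum_mul] at h1
    nlinarith [mul_le_mul_of_nonneg_left hbias hn0]
  have hnoise' : ρ * Real.sqrt (∑ i ∈ I, w i ^ 2 * deriv μ ⟪a i, θ⟫ * ⟪a i, z⟫ ^ 2 + lam * n ^ 2)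
      ≤ ρ * (Real.sqrt (1 + n) * u) := by
    refine mul_le_mul_of_nonneg_left (le_trans (Real.sqrt_le_sqrt ?_) hAsqrt) hρ
    refine add_le_add (Finset.sum_le_sum fun i hi => ?_) le_rfl
    -- As `w ≤ p ≤ 1`, the noise covariance, which carries squared weights, is dominated by the
    -- information with weights `p`.
    have h1 : w i ^ 2 ≤ p i := by
      have := hw0 i hi
      have := hw i hi
      have := hp i hi
      nlinarith
    have := hμ' ⟪a i, θ⟫
    gcongr
  refine hAsqrt.trans (sqrt_one_add_mul_le hlam hρ hbar hn0 hu0 hnu ?_)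
  rw [huu]
  linarith

end Prediction

/-! ### Discounted elliptical potential -/

section EllipticPotential

variable {d : ℕ}

lemma quadForm_inv_le_div {M : Matrix (Fin d) (Fin d) ℝ} (hM : M.PosDef) {c : ℝ} (hc : 0 < c)
    (h : ∀ x, c * ‖x‖ ^ 2 ≤ quadForm M x) (x : Vec d) : quadForm M⁻¹ x ≤ ‖x‖ ^ 2 / c := by
  obtain ⟨h1, h2⟩ := quadForm_inv_eq hM x
  set y : Vec d := WithLp.toLp 2 (M⁻¹ *ᵥ x.ofLp)
  have h3 := h y
  have h4 := real_inner_le_norm x y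
  rw [h1] at h3
  rw [h2] at h4
  have h5 := quadForm_nonneg hM.inv x
  rw [le_div_iff₀ hc]
  rcases h5.eq_or_lt with h0 | h0
  · rw [← h0, zero_mul]; positivity
  · refine le_of_mul_le_mul_right ?_ h0
    have h6 : quadForm M⁻¹ x ^ 2 ≤ (‖x‖ * ‖y‖) ^ 2 := by gcongr
    nlinarith [mul_le_mul_of_nonneg_left h3 (sq_nonneg ‖x‖)]

lemma min_one_le_two_mul_log {x : ℝ} (hx : 0 ≤ x) : min 1 x ≤ 2 * Real.log (1 + x) := by
  have hmin : 0 ≤ min 1 x := le_min zero_le_one hx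
  have h1 := Real.le_log_one_add_of_nonneg hmin
  have h2 : Real.log (1 + min 1 x) ≤ Real.log (1 + x) :=
    Real.log_le_log (by linarith) (by linarith [min_le_right 1 x])
  have h3 : min 1 x / 2 ≤ 2 * min 1 x / (min 1 x + 2) := by
    rw [div_le_div_iff₀ (by norm_num) (by linarith)]
    nlinarith [min_le_left 1 x]
  linarith

/-- With the regularizer discounted too, the update is exactly scaling plus a rank-one term, so
determinants satisfy a clean recursion. -/
lemma gram_succ {γ : ℝ} (a : ℕ → Vec d) (c : ℝ) (n : ℕ) :
    gram (Finset.Icc 1 (n + 1)) (fun s => γ ^ (n + 1 - s)) a (c * γ ^ (n + 1))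
      = γ • gram (Finset.Icc 1 n) (fun s => γ ^ (n - s)) a (c * γ ^ n)
        + Matrix.vecMulVec (a (n + 1)).ofLp (a (n + 1)).ofLp := by
  rw [gram, gram, Finset.sum_Icc_succ_top (by omega), smul_add, Finset.smul_sum, smul_smul,
    Nat.sub_self, pow_zero, one_smul, add_right_comm]
  congr 2
  · refine Finset.sum_congr rfl fun s hs => ?_
    rw [Finset.mem_Icc] at hs
    rw [smul_smul, show n + 1 - s = n - s + 1 by omega, pow_succ, mul_comm]
  · ring_nf

/-- Elliptical potential bound for discounted design matrices. -/
lemma sum_quadForm_inv_le {γ c : ℝ} (h0 : 0 < γ) (h1 : γ < 1) (hc : 0 < c) (hd : 1 ≤ d) {T : ℕ}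
    {a : ℕ → Vec d} (ha : ∀ s, 1 ≤ s → s ≤ T → ‖a s‖ ≤ 1) :
    ∑ t ∈ Finset.Icc 1 T,
        quadForm (gram (Finset.Icc 1 (t - 1)) (fun s => γ ^ (t - 1 - s)) a c)⁻¹ (a t)
      ≤ max 1 (1 / c) * (2 * (d * (T * Real.log (1 / γ)
          + Real.log (1 + 1 / (d * c * (1 - γ)))))) := by
  have hγ : 0 < 1 - γ := by linarith
  have hd0 : (0 : ℝ) < d := by exact_mod_cast hd
  -- The potential argument runs on these smaller matrices. The true design matrix dominates them,
  -- so its inverse form is the smaller one.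
  set U : ℕ → Matrix (Fin d) (Fin d) ℝ := fun n =>
    gram (Finset.Icc 1 n) (fun s => γ ^ (n - s)) a (c * γ ^ n) with hU
  have hUpd : ∀ n, (U n).PosDef := fun n =>
    gram_posDef a (fun s _ => by positivity) (by positivity)
  have hdet : ∀ n, Real.log (1 + quadForm (U n)⁻¹ (a (n + 1)))
      ≤ Real.log (U (n + 1)).det - Real.log (U n).det + d * Real.log (1 / γ) := fun n => by
    have hq := quadForm_nonneg (hUpd n).inv (a (n + 1))
    have h2 : (U (n + 1)).det
        = γ ^ d * (U n).det * (1 + γ⁻¹ * quadForm (U n)⁻¹ (a (n + 1))) := by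
      rw [← det_smul_add_vecMulVec (hUpd n) h0, hU]
      simp only
      rw [gram_succ]
    have hp := (hUpd n).det_pos
    rw [h2, Real.log_mul (by positivity) (by positivity), Real.log_mul (by positivity) hp.ne',
      Real.log_pow, one_div, Real.log_inv]
    have h3 : Real.log (1 + quadForm (U n)⁻¹ (a (n + 1)))
        ≤ Real.log (1 + γ⁻¹ * quadForm (U n)⁻¹ (a (n + 1))) := by
      refine Real.log_le_log (by linarith) ?_
      have : 1 ≤ γ⁻¹ := (one_le_inv₀ h0).2 h1.le
      nlinarith
    linarith
  have hsum : ∀ n, ∑ t ∈ Finset.Icc 1 n, Real.log (1 + quadForm (U (t - 1))⁻¹ (a t))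
      ≤ Real.log (U n).det - d * Real.log c + n * (d * Real.log (1 / γ)) := fun n => by
    induction n with
    | zero =>
      have : U 0 = c • (1 : Matrix (Fin d) (Fin d) ℝ) := by simp [hU, gram]
      rw [this, Matrix.det_smul]
      simp
    | succ n ih =>
      rw [Finset.sum_Icc_succ_top (by omega), Nat.add_sub_cancel]
      have := hdet n
      push_cast
      linarith
  have hdetT : Real.log (U T).det ≤ d * Real.log (c + 1 / (d * (1 - γ))) := by
    refine log_det_le (hUpd T) ?_ (by positivity)
    rw [hU]
    simp only
    rw [trace_gram]
    have h2 : ∑ i ∈ Finset.Icc 1 T, γ ^ (T - i) * ‖a i‖ ^ 2 ≤ 1 / (1 - γ) := by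
      calc ∑ i ∈ Finset.Icc 1 T, γ ^ (T - i) * ‖a i‖ ^ 2 ≤ ∑ i ∈ Finset.Icc 1 T, γ ^ (T - i) := by
            refine Finset.sum_le_sum fun i hi => ?_
            rw [Finset.mem_Icc] at hi
            exact mul_le_of_le_one_right (by positivity)
              (pow_le_one₀ (norm_nonneg _) (ha i hi.1 hi.2))
        _ = ∑ j ∈ Finset.range T, γ ^ j := sum_Icc_lag (fun j => γ ^ j) (T + 1)
        _ ≤ _ := sum_range_pow_le h0.le h1 T
    have h3 : c * γ ^ T * d ≤ c * d := by
      have : γ ^ T ≤ 1 := pow_le_one₀ h0.le h1.le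
      have : c * γ ^ T ≤ c := by nlinarith
      gcongr
    have h4 : (d : ℝ) * (c + 1 / (d * (1 - γ))) = 1 / (1 - γ) + c * d := by
      field_simp
      ring
    linarith
  have hlog : Real.log (c + 1 / (d * (1 - γ)))
      = Real.log c + Real.log (1 + 1 / (d * c * (1 - γ))) := by
    rw [← Real.log_mul hc.ne' (by positivity)]
    congr 1
    field_simp
  rw [hlog] at hdetT
  -- The form of `U⁻¹` may be large since its regularizer decays, whereas that of `V⁻¹` never
  -- exceeds `1 / c`. Hence the minimum with `1` and the factor `max 1 (1 / c)`.
  have hterm : ∀ t ∈ Finset.Icc 1 T,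
      quadForm (gram (Finset.Icc 1 (t - 1)) (fun s => γ ^ (t - 1 - s)) a c)⁻¹ (a t)
        ≤ max 1 (1 / c) * (2 * Real.log (1 + quadForm (U (t - 1))⁻¹ (a t))) := fun t ht => by
    rw [Finset.mem_Icc] at ht
    set V := gram (Finset.Icc 1 (t - 1)) (fun s => γ ^ (t - 1 - s)) a c with hV
    have hVpd : V.PosDef := gram_posDef a (fun s _ => by positivity) hc
    have hq := quadForm_nonneg (hUpd (t - 1)).inv (a t)
    have hqV : quadForm V⁻¹ (a t) ≤ quadForm (U (t - 1))⁻¹ (a t) := by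
      refine quadForm_inv_anti (hUpd _) hVpd (fun x => ?_) _
      rw [hU, hV]
      simp only
      rw [quadForm_gram, quadForm_gram]
      have : γ ^ (t - 1) ≤ 1 := pow_le_one₀ h0.le h1.le
      have : c * γ ^ (t - 1) ≤ c := by nlinarith
      gcongr
    have hqc : quadForm V⁻¹ (a t) ≤ 1 / c := by
      refine (quadForm_inv_le_div hVpd hc (fun x => ?_) _).trans ?_
      · rw [hV, quadForm_gram]
        exact le_add_of_nonneg_left (Finset.sum_nonneg fun s _ => by positivity)
      · have := pow_le_one₀ (n := 2) (norm_nonneg _) (ha t ht.1 ht.2)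
        gcongr
    have hmax0 : 0 ≤ max 1 (1 / c) := le_trans zero_le_one (le_max_left _ _)
    refine le_trans ?_ (mul_le_mul_of_nonneg_left (min_one_le_two_mul_log hq) hmax0)
    rcases le_total 1 (quadForm (U (t - 1))⁻¹ (a t)) with h | h
    · rw [min_eq_left h, mul_one]
      exact hqc.trans (le_max_right _ _)
    · rw [min_eq_right h]
      exact hqV.trans (le_mul_of_one_le_left hq (le_max_left _ _))
  refine (Finset.sum_le_sum hterm).trans ?_
  rw [← Finset.mul_sum, ← Finset.mul_sum]
  have hmax0 : 0 ≤ max 1 (1 / c) := le_trans zero_le_one (le_max_left _ _)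
  refine mul_le_mul_of_nonneg_left ?_ hmax0
  have := hsum T
  linarith

end EllipticPotential

end

end GLBandit

namespace GLBandit

noncomputable section

namespace Run

variable {d : ℕ} {Ω : Type u} [mΩ : MeasurableSpace Ω] {B : Run d Ω} {P : Measure Ω}
  {T D : ℕ} {S m lam γ δ Δ : ℝ} {k : ℝ≥0} {w : ℕ → ℝ}

lemma StandingAssumptions.deriv_mean_nonneg (hS : B.StandingAssumptions P T S m k) (x : ℝ) :
    0 ≤ deriv B.family.mean x :=
  deriv_nonneg_of_selfConcordant hS.selfConcordant x

lemma StandingAssumptions.deriv_mean_le (hS : B.StandingAssumptions P T S m k) (x : ℝ) :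
    deriv B.family.mean x ≤ k :=
  (Real.le_norm_self _).trans (norm_deriv_le_of_lipschitz hS.mean_lipschitz)

lemma StandingAssumptions.cμ_le (hS : B.StandingAssumptions P T S m k) {a θ : Vec d}
    (ha : ‖a‖ ≤ 1) (hθ : ‖θ‖ ≤ S) : B.cμ S ≤ deriv B.family.mean ⟪a, θ⟫ := by
  refine csInf_le ⟨0, ?_⟩ ⟨θ, a, hθ, ha, rfl⟩
  rintro y ⟨θ', a', -, -, rfl⟩
  exact hS.deriv_mean_nonneg _

lemma StandingAssumptions.cμ_le_lipschitz (hS : B.StandingAssumptions P T S m k) (hT : 1 ≤ T) :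
    B.cμ S ≤ k :=
  (hS.cμ_le (a := 0) (by simp) (hS.norm_θ_le 1 le_rfl hT)).trans (hS.deriv_mean_le _)

lemma StandingAssumptions.radius_nonneg (hS : B.StandingAssumptions P T S m k) (hT : 1 ≤ T) :
    0 ≤ S := (norm_nonneg _).trans (hS.norm_θ_le 1 le_rfl hT)

lemma IsInteraction.norm_action_le (hB : B.IsInteraction P T)
    (hS : B.StandingAssumptions P T S m k) {t : ℕ} (h1 : 1 ≤ t) (ht : t ≤ T) (ω : Ω) :
    ‖B.a t ω‖ ≤ 1 :=
  hS.norm_action_le t h1 ht ω _ (hB.mem_A t h1 ht ω)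

lemma designMatrix_eq_gram (B : Run d Ω) (S lam γ : ℝ) (t : ℕ) (ω : Ω) :
    B.designMatrix S lam γ t ω
      = gram (Finset.Icc 1 (t - 1)) (fun s => γ ^ (t - 1 - s)) (fun s => B.a s ω)
          (lam / B.cμ S) := rfl

lemma rho_nonneg (hT : 1 ≤ T) (hm : 0 < m) (hlam : 0 < lam) (h0 : 0 < γ) (h1 : γ < 1)
    (hδ : 0 < δ) (hδ1 : δ ≤ 1) : 0 ≤ rho d T m k lam γ δ := by
  have hT1 : (1 : ℝ) ≤ T := by exact_mod_cast hT
  have h2 : 0 ≤ Real.log (T / δ) := Real.log_nonneg (by rw [le_div_iff₀ hδ]; linarith)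
  have h3 : 0 ≤ 1 - 1 / (T : ℝ) ^ 2 := by
    rw [sub_nonneg, div_le_one (by positivity)]
    nlinarith
  have h4 : 0 < 1 - γ ^ 2 := by nlinarith
  have h5 : 0 ≤ Real.log (1 + k * (1 - 1 / (T : ℝ) ^ 2) / (d * lam * (1 - γ ^ 2))) := by
    refine Real.log_nonneg (le_add_of_nonneg_right ?_)
    positivity
  have h6 : 0 ≤ Real.log 2 := Real.log_nonneg (by norm_num)
  unfold rho
  positivity

/-- First-order optimality of the estimator. -/
lemma sum_residual_of_isMin {t : ℕ} {ω : Ω} {θhat : Vec d}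
    (hmin : ∀ θ', B.penalizedNLL lam γ t ω θhat ≤ B.penalizedNLL lam γ t ω θ') (z : Vec d) :
    ∑ s ∈ Finset.Icc 1 (t - 1), γ ^ (t - 1 - s)
        * (B.r (s + 1) ω - B.family.mean ⟪B.a s ω, θhat⟫) * ⟪B.a s ω, z⟫ = lam * ⟪θhat, z⟫ := by
  have hb : Differentiable ℝ B.family.b := B.family.contDiff_b.differentiable (by norm_num)
  have hlin : ∀ s, HasDerivAt (fun h : ℝ => ⟪B.a s ω, θhat + h • z⟫) ⟪B.a s ω, z⟫ 0 := by
    intro s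
    simp_rw [inner_add_right, inner_smul_right]
    simpa using (hasDerivAt_id (0 : ℝ)).mul_const ⟪B.a s ω, z⟫ |>.const_add ⟪B.a s ω, θhat⟫
  have hlog : ∀ s, HasDerivAt
      (fun h : ℝ => B.family.logDensity ⟪B.a s ω, θhat + h • z⟫ (B.r (s + 1) ω))
      ((B.r (s + 1) ω - B.family.mean ⟪B.a s ω, θhat⟫) * ⟪B.a s ω, z⟫) 0 := by
    intro s
    have h1 : HasDerivAt B.family.b (B.family.mean ⟪B.a s ω, θhat + (0 : ℝ) • z⟫)
        ⟪B.a s ω, θhat + (0 : ℝ) • z⟫ := (hb _).hasDerivAt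
    have h2 := (((hlin s).const_mul (B.r (s + 1) ω)).sub (h1.comp 0 (hlin s))).add_const
      (B.family.c (B.r (s + 1) ω))
    refine h2.congr_deriv ?_
    simp only [zero_smul, add_zero]
    ring
  have hnorm : HasDerivAt (fun h : ℝ => ‖θhat + h • z‖ ^ 2) (2 * ⟪θhat, z⟫) 0 := by
    have h1 : HasDerivAt (fun h : ℝ => θhat + h • z) z 0 := by
      simpa using ((hasDerivAt_id (0 : ℝ)).smul_const z).const_add θhat
    simpa using h1.norm_sq
  have htot : HasDerivAt (fun h : ℝ => B.penalizedNLL lam γ t ω (θhat + h • z))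
      (-(∑ s ∈ Finset.Icc 1 (t - 1), γ ^ (t - 1 - s)
        * ((B.r (s + 1) ω - B.family.mean ⟪B.a s ω, θhat⟫) * ⟪B.a s ω, z⟫))
        + lam / 2 * (2 * ⟪θhat, z⟫)) 0 := by
    unfold penalizedNLL
    exact (HasDerivAt.fun_sum fun s _ => (hlog s).const_mul _).neg.add (hnorm.const_mul _)
  have hloc : IsLocalMin (fun h : ℝ => B.penalizedNLL lam γ t ω (θhat + h • z)) 0 := by
    refine Filter.Eventually.of_forall fun h => ?_
    simpa using hmin (θhat + h • z)
  have := hloc.hasDerivAt_eq_zero htot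
  simp_rw [mul_assoc]
  linarith

/-- The favourable event: rewards are in range and every noise vector is within its threshold. -/
def Favourable (B : Run d Ω) (T : ℕ) (m lam ρ : ℝ) (w : ℕ → ℝ) (ω : Ω) : Prop :=
  ∀ t, 1 ≤ t → t ≤ T → (0 ≤ B.r (t + 1) ω ∧ B.r (t + 1) ω ≤ m) ∧
    ∀ z, ⟪z, B.noise (fun s => w (t - 1 - s)) t ω⟫
      ≤ ρ * Real.sqrt (quadForm (B.noiseGram (fun s => w (t - 1 - s)) lam t ω) z)

/-- Arithmetic–geometric mean for the eigenvalues, with the trace controlled by the squared mass of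
the weights and `μ' ≤ k`. -/
lemma IsInteraction.log_det_noiseGram_le (hB : B.IsInteraction P T)
    (hS : B.StandingAssumptions P T S m k) (hd : 1 ≤ d) (hT : 1 ≤ T) (hlam : 0 < lam) (h0 : 0 < γ)
    (h1 : γ < 1)
    (hw2 : ∀ n, ∑ j ∈ Finset.range n, w j ^ 2 ≤ (1 - 1 / (T : ℝ) ^ 2) / (1 - γ ^ 2))
    {t : ℕ} (ht : t ≤ T) (ω : Ω) :
    Real.log (B.noiseGram (fun s => w (t - 1 - s)) lam t ω).det - d * Real.log lam
      ≤ d * Real.log (1 + k * (1 - 1 / (T : ℝ) ^ 2) / (d * lam * (1 - γ ^ 2))) := by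
  have hd0 : (0 : ℝ) < d := by exact_mod_cast hd
  have hT1 : (1 : ℝ) ≤ T := by exact_mod_cast hT
  have h3 : 0 ≤ 1 - 1 / (T : ℝ) ^ 2 := by
    rw [sub_nonneg, div_le_one (by positivity)]
    nlinarith
  have h4 : 0 < 1 - γ ^ 2 := by nlinarith
  set x := k * (1 - 1 / (T : ℝ) ^ 2) / (d * lam * (1 - γ ^ 2)) with hx
  have hx0 : 0 ≤ x := by positivity
  have h5 : Real.log (B.noiseGram (fun s => w (t - 1 - s)) lam t ω).det
      ≤ d * Real.log (lam * (1 + x)) := by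
    have hpd : (B.noiseGram (fun s => w (t - 1 - s)) lam t ω).PosDef :=
      gram_posDef _ (fun s _ => mul_nonneg (sq_nonneg _) (hS.deriv_mean_nonneg _)) hlam
    refine log_det_le hpd ?_ (by positivity)
    rw [noiseGram, trace_gram]
    have h6 : ∑ s ∈ Finset.Icc 1 (t - 1),
        w (t - 1 - s) ^ 2 * deriv B.family.mean (B.natParam s ω) * ‖B.a s ω‖ ^ 2
          ≤ k * ((1 - 1 / (T : ℝ) ^ 2) / (1 - γ ^ 2)) := by
      calc _ ≤ ∑ s ∈ Finset.Icc 1 (t - 1), k * w (t - 1 - s) ^ 2 := by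
            refine Finset.sum_le_sum fun s hs => ?_
            rw [Finset.mem_Icc] at hs
            have h7 := pow_le_one₀ (n := 2) (norm_nonneg _)
              (hB.norm_action_le hS hs.1 (show s ≤ T by omega) ω)
            have h8 := hS.deriv_mean_le (B.natParam s ω)
            have h9 := hS.deriv_mean_nonneg (B.natParam s ω)
            calc _ ≤ w (t - 1 - s) ^ 2 * k * 1 := by gcongr
              _ = _ := by ring
        _ = k * ∑ j ∈ Finset.range (t - 1), w j ^ 2 := by
            rw [← Finset.mul_sum, sum_Icc_lag fun j => w j ^ 2]
        _ ≤ _ := by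
            gcongr
            exact hw2 _
    have h10 : (d : ℝ) * (lam * (1 + x))
        = k * ((1 - 1 / (T : ℝ) ^ 2) / (1 - γ ^ 2)) + lam * d := by
      rw [hx]
      field_simp
      ring
    linarith
  rw [Real.log_mul hlam.ne' (by positivity)] at h5
  linarith

/-- The favourable event has probability at least `1 - δ`. -/
lemma IsInteraction.measure_not_favourable_le [IsProbabilityMeasure P] (hB : B.IsInteraction P T)
    (hS : B.StandingAssumptions P T S m k) (hd : 1 ≤ d) (hT : 1 ≤ T) (hm : 0 < m) (hlam : 0 < lam)
    (h0 : 0 < γ) (h1 : γ < 1) (hδ : 0 < δ) (hw0 : ∀ j, 0 ≤ w j) (hw : ∀ j, w j ≤ γ ^ j)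
    (hw2 : ∀ n, ∑ j ∈ Finset.range n, w j ^ 2 ≤ (1 - 1 / (T : ℝ) ^ 2) / (1 - γ ^ 2)) :
    P {ω | ¬ B.Favourable T m lam (rho d T m k lam γ δ) w ω} ≤ ENNReal.ofReal δ := by
  have hT0 : (0 : ℝ) < T := by exact_mod_cast hT
  set ρ := rho d T m k lam γ δ with hρ
  set bad : ℕ → Set Ω := fun t =>
    {ω | ∃ z, ρ * Real.sqrt (quadForm (B.noiseGram (fun s => w (t - 1 - s)) lam t ω) z)
      < ⟪z, B.noise (fun s => w (t - 1 - s)) t ω⟫} with hbad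
  have hbadP : ∀ t ∈ Finset.Icc 1 T, P (bad t) ≤ ENNReal.ofReal (δ / T) := fun t ht => by
    rw [Finset.mem_Icc] at ht
    -- The level `L = log (T / δ)` gives each round a failure probability `δ / T`.
    have h2 : Real.exp (-Real.log (T / δ)) = δ / T := by
      rw [← Real.log_inv, Real.exp_log (by positivity), inv_div]
    rw [← h2]
    refine hB.measure_noise_le hm hS (fun s => hw0 _)
      (fun s => (hw _).trans (pow_le_one₀ h0.le h1.le)) hlam ht.2 fun ω => ?_
    have h3 := hB.log_det_noiseGram_le hS hd hT hlam h0 h1 hw2 ht.2 ω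
    have h4 : 0 ≤ 2 * m / Real.sqrt lam := by positivity
    rw [hρ, rho]
    have h5 := mul_le_mul_of_nonneg_left h3 (show 0 ≤ m / Real.sqrt lam by positivity)
    have h6 : ∀ y : ℝ, 2 * m / Real.sqrt lam * (y / 2) = m / Real.sqrt lam * y := fun y => by ring
    rw [mul_add, mul_add, h6]
    have h7 : ∀ y : ℝ, d * m / Real.sqrt lam * y = m / Real.sqrt lam * (d * y) := fun y => by ring
    rw [h7]
    linarith
  have hr0 : P {ω | ¬ ∀ t, 1 ≤ t → t ≤ T → 0 ≤ B.r (t + 1) ω ∧ B.r (t + 1) ω ≤ m} = 0 := by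
    rw [← ae_iff, ae_all_iff]
    intro t
    by_cases h : 1 ≤ t ∧ t ≤ T
    · filter_upwards [hS.reward_mem t h.1 h.2] with ω hω _ _ using hω
    · exact Filter.Eventually.of_forall fun ω h2 h3 => absurd ⟨h2, h3⟩ h
  have hsub : {ω | ¬ B.Favourable T m lam ρ w ω}
      ⊆ {ω | ¬ ∀ t, 1 ≤ t → t ≤ T → 0 ≤ B.r (t + 1) ω ∧ B.r (t + 1) ω ≤ m}
        ∪ ⋃ t ∈ Finset.Icc 1 T, bad t := by
    intro ω hω
    by_contra hcon
    simp only [Set.mem_union, Set.mem_ofPred_eq, not_or, not_not, Set.mem_iUnion, Finset.mem_Icc,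
      not_exists, hbad, not_lt] at hcon
    exact hω fun t ht1 ht2 => ⟨hcon.1 t ht1 ht2, hcon.2 t ⟨ht1, ht2⟩⟩
  calc _ ≤ _ := measure_mono hsub
    _ ≤ 0 + ∑ t ∈ Finset.Icc 1 T, P (bad t) := by
        rw [← hr0]
        exact (measure_union_le _ _).trans (add_le_add le_rfl (measure_biUnion_finset_le _ _))
    _ ≤ 0 + ∑ t ∈ Finset.Icc 1 T, ENNReal.ofReal (δ / T) := by
        gcongr with t ht
        exact hbadP t ht
    _ = ENNReal.ofReal δ := by
        rw [zero_add, Finset.sum_const, Nat.card_Icc, Nat.add_sub_cancel, nsmul_eq_mul,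
          ← ENNReal.ofReal_natCast, ← ENNReal.ofReal_mul hT0.le]
        congr 1
        field_simp

lemma IsInteraction.mean_mem [IsProbabilityMeasure P] (hB : B.IsInteraction P T)
    (hS : B.StandingAssumptions P T S m k) (hT : 1 ≤ T) (x : ℝ) :
    B.family.mean x ∈ Set.Icc 0 m :=
  ExpFamily.mean_mem (hB.ae_reference hT hS) x

/-- Prediction error of the estimator in a round whose window contains no parameter change. -/
lemma IsInteraction.abs_mean_sub_le [IsProbabilityMeasure P] (hB : B.IsInteraction P T)
    (hS : B.StandingAssumptions P T S m k) (hT : 1 ≤ T) (hm : 0 < m) (hlam : 0 < lam) (h0 : 0 < γ)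
    (h1 : γ < 1) (hδ : 0 < δ) (hδ1 : δ ≤ 1) (hw0 : ∀ j, 0 ≤ w j) (hw : ∀ j, w j ≤ γ ^ j)
    (hwD : ∀ j, D < j → w j = 0)
    (hwb : ∀ n, ∑ j ∈ Finset.range n, (γ ^ j - w j) ≤ 1 / (T * (1 - γ)))
    {ω : Ω} (hω : B.Favourable T m lam (rho d T m k lam γ δ) w ω) {t : ℕ} (ht1 : 1 ≤ t)
    (ht : t ≤ T) (hwin : ∀ s, 1 ≤ s → s ≤ t - 1 → t - 1 - s ≤ D → B.θ s = B.θ t)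
    {θhat : Vec d}
    (hmin : ∀ θ', B.penalizedNLL lam γ t ω θhat ≤ B.penalizedNLL lam γ t ω θ') (x : Vec d) :
    |B.family.mean ⟪x, θhat⟫ - B.family.mean ⟪x, B.θ t⟫|
      ≤ beta d T S m k lam γ δ / Real.sqrt (B.cμ S)
          * matNorm (B.designMatrix S lam γ t ω)⁻¹ x := by
  have hT0 : (0 : ℝ) < T := by exact_mod_cast hT
  have hγ : 0 < 1 - γ := by linarith
  have hc : 0 < B.cμ S := hS.cMu_pos
  set ρ := rho d T m k lam γ δ with hρdef
  set z := θhat - B.θ t with hz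
  -- The noise is centred at the parameter of each past round. Where its weight is nonzero that
  -- parameter is the current one, so noise and covariance may be rewritten at `B.θ t`.
  have hθw : ∀ s ∈ Finset.Icc 1 (t - 1), w (t - 1 - s) ≠ 0 → B.θ s = B.θ t := fun s hs hne => by
    rw [Finset.mem_Icc] at hs
    exact hwin s hs.1 hs.2 (not_lt.1 fun h => hne (hwD _ h))
  have hnoise := (hω t ht1 ht).2 z
  rw [noiseGram, quadForm_gram, noise, inner_sum] at hnoise
  have e1 : ∑ s ∈ Finset.Icc 1 (t - 1), ⟪z, (w (t - 1 - s)
        * (B.r (s + 1) ω - B.family.mean (B.natParam s ω))) • B.a s ω⟫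
      = ∑ s ∈ Finset.Icc 1 (t - 1), w (t - 1 - s)
        * (B.r (s + 1) ω - B.family.mean ⟪B.a s ω, B.θ t⟫) * ⟪B.a s ω, z⟫ := by
    refine Finset.sum_congr rfl fun s hs => ?_
    rw [inner_smul_right, real_inner_comm]
    by_cases h : w (t - 1 - s) = 0
    · simp [h]
    · rw [natParam, hθw s hs h]
  have e2 : ∑ s ∈ Finset.Icc 1 (t - 1), w (t - 1 - s) ^ 2
        * deriv B.family.mean (B.natParam s ω) * ⟪B.a s ω, z⟫ ^ 2
      = ∑ s ∈ Finset.Icc 1 (t - 1), w (t - 1 - s) ^ 2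
        * deriv B.family.mean ⟪B.a s ω, B.θ t⟫ * ⟪B.a s ω, z⟫ ^ 2 := by
    refine Finset.sum_congr rfl fun s hs => ?_
    by_cases h : w (t - 1 - s) = 0
    · simp [h]
    · rw [natParam, hθw s hs h]
  rw [e1, e2] at hnoise
  have hbias : m * ∑ s ∈ Finset.Icc 1 (t - 1), (γ ^ (t - 1 - s) - w (t - 1 - s)) + lam * S
      ≤ lam * barS T S m k lam γ := by
    rw [sum_Icc_lag fun j => γ ^ j - w j]
    have h2 := mul_le_mul_of_nonneg_left (hwb (t - 1)) hm.le
    have h3 : lam * barS T S m k lam γ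
        = lam * S + 2 * S * k / (T * (1 - γ)) + m * (1 / (T * (1 - γ))) := by
      unfold barS
      field_simp
      ring
    -- The residuals at `B.θ t` are bounded by `m` in every round, so the bias needs only the
    -- summand `m` of `S̄`; the summand `2Sk` is dropped as slack.
    have h4 : 0 ≤ 2 * S * k / (T * (1 - γ)) := by
      have := hS.radius_nonneg hT
      positivity
    linarith
  have hact : ∀ s ∈ Finset.Icc 1 (t - 1), ‖B.a s ω‖ ≤ 1 := fun s hs => by
    rw [Finset.mem_Icc] at hs
    exact hB.norm_action_le hS hs.1 (by omega) ω
  have hθ := hS.norm_θ_le t ht1 ht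
  have key := sqrt_information_le (hS.mean_contDiff.differentiable (by norm_num))
    hS.deriv_mean_differentiable hS.selfConcordant (I := Finset.Icc 1 (t - 1))
    (p := fun s => γ ^ (t - 1 - s)) (w := fun s => w (t - 1 - s)) (r := fun s => B.r (s + 1) ω)
    (a := fun s => B.a s ω) (θ := B.θ t) (θhat := θhat) hlam
    (rho_nonneg (d := d) (k := k) hT hm hlam h0 h1 hδ hδ1) (fun s _ => pow_le_one₀ h0.le h1.le)
    (fun s _ => hw0 _) (fun s _ => hw _) hact hθ
    (fun s hs => by
      rw [Finset.mem_Icc] at hs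
      have h2 := (hω s hs.1 (by omega)).1
      have h3 := hB.mean_mem hS hT ⟪B.a s ω, B.θ t⟫
      exact abs_sub_le_of_nonneg_of_le h2.1 h2.2 h3.1 h3.2)
    hbias (sum_residual_of_isMin hmin _) hnoise
  have hVpd : (B.designMatrix S lam γ t ω).PosDef :=
    gram_posDef _ (fun s _ => by positivity) (by positivity)
  -- Multiplied by `c_μ`, the design form lies below the information form at the true parameter, and
  -- its regularizer `λ / c_μ` becomes exactly `λ`.
  have hV : Real.sqrt (quadForm (B.designMatrix S lam γ t ω) z)
      ≤ Real.sqrt (∑ s ∈ Finset.Icc 1 (t - 1), γ ^ (t - 1 - s)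
        * deriv B.family.mean ⟪B.a s ω, B.θ t⟫ * ⟪B.a s ω, z⟫ ^ 2 + lam * ‖z‖ ^ 2)
        / Real.sqrt (B.cμ S) := by
    rw [← Real.sqrt_div' _ hc.le]
    refine Real.sqrt_le_sqrt ?_
    rw [le_div_iff₀ hc, designMatrix_eq_gram, quadForm_gram, add_mul, Finset.sum_mul]
    refine add_le_add (Finset.sum_le_sum fun s hs => ?_) (le_of_eq (by field_simp))
    have h2 := hS.cμ_le (hact s hs) hθ
    calc γ ^ (t - 1 - s) * ⟪B.a s ω, z⟫ ^ 2 * B.cμ S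
        = γ ^ (t - 1 - s) * B.cμ S * ⟪B.a s ω, z⟫ ^ 2 := by ring
      _ ≤ _ := by gcongr
  have hlip : |B.family.mean ⟪x, θhat⟫ - B.family.mean ⟪x, B.θ t⟫| ≤ k * |⟪x, z⟫| := by
    have := hS.mean_lipschitz.dist_le_mul ⟪x, θhat⟫ ⟪x, B.θ t⟫
    rw [Real.dist_eq, Real.dist_eq, ← inner_sub_right] at this
    exact this
  have hN : 0 ≤ matNorm (B.designMatrix S lam γ t ω)⁻¹ x := Real.sqrt_nonneg _
  calc _ ≤ k * |⟪x, z⟫| := hlip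
    _ ≤ k * (matNorm (B.designMatrix S lam γ t ω)⁻¹ x * ((Real.sqrt lam
          * (1 + barS T S m k lam γ + Real.sqrt ((1 + barS T S m k lam γ) / lam) * ρ
            + (ρ / Real.sqrt lam) ^ 2) ^ (3 / 2 : ℝ)) / Real.sqrt (B.cμ S))) := by
        gcongr
        refine (abs_inner_le_matNorm_inv_mul hVpd x z).trans ?_
        gcongr
        exact hV.trans (by gcongr)
    _ = _ := by
        rw [beta, ← hρdef]
        ring

/-! ### Reward gaps, unstable rounds and the regret on the favourable event -/

section Gap

lemma IsInteraction.bddAbove_means [IsProbabilityMeasure P] (hB : B.IsInteraction P T)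
    (hS : B.StandingAssumptions P T S m k) (hT : 1 ≤ T) (t : ℕ) (ω : Ω) :
    BddAbove ((fun x : Vec d => B.family.mean ⟪x, B.θ t⟫) '' B.A t ω) := by
  refine ⟨m, ?_⟩
  rintro _ ⟨x, -, rfl⟩
  exact (hB.mean_mem hS hT _).2

/-- A positive minimal gap forces the best mean to be attained. -/
lemma IsInteraction.exists_bestMean_eq [IsProbabilityMeasure P] (hB : B.IsInteraction P T)
    (hΔ : 0 < Δ) (hgap : B.MinGap T Δ) {t : ℕ} (ht1 : 1 ≤ t) (ht : t ≤ T) (ω : Ω) :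
    ∃ x ∈ B.A t ω, B.bestMean t ω ≤ B.family.mean ⟪x, B.θ t⟫ := by
  by_contra! hcon
  have h1 : B.bestMean t ω ≤ B.bestMean t ω - Δ := by
    refine csSup_le ⟨_, ⟨_, hB.mem_A t ht1 ht ω, rfl⟩⟩ ?_
    rintro _ ⟨x, hx, rfl⟩
    have := hgap t ht1 ht ω x hx (hcon x hx)
    simp only
    linarith
  linarith

/-- The instantaneous regret. -/
def gap (B : Run d Ω) (t : ℕ) (ω : Ω) : ℝ :=
  B.bestMean t ω - B.family.mean ⟪B.a t ω, B.θ t⟫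

lemma IsInteraction.gap_nonneg [IsProbabilityMeasure P] (hB : B.IsInteraction P T)
    (hS : B.StandingAssumptions P T S m k) {t : ℕ} (ht1 : 1 ≤ t) (ht : t ≤ T) (ω : Ω) :
    0 ≤ B.gap t ω :=
  sub_nonneg.2 (le_csSup (hB.bddAbove_means hS (ht1.trans ht) t ω)
    ⟨_, hB.mem_A t ht1 ht ω, rfl⟩)

lemma IsInteraction.gap_le [IsProbabilityMeasure P] (hB : B.IsInteraction P T)
    (hS : B.StandingAssumptions P T S m k) {t : ℕ} (ht1 : 1 ≤ t) (ht : t ≤ T) (ω : Ω) :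
    B.gap t ω ≤ m := by
  have h1 : B.bestMean t ω ≤ m := by
    refine csSup_le ⟨_, ⟨_, hB.mem_A t ht1 ht ω, rfl⟩⟩ ?_
    rintro _ ⟨x, -, rfl⟩
    exact (hB.mean_mem hS (ht1.trans ht) _).2
  have := (hB.mean_mem hS (ht1.trans ht) ⟪B.a t ω, B.θ t⟫).1
  unfold gap
  linarith

/-- A gap is either zero or at least `Δ`. This conversion to squares lets the potential bound apply
without Cauchy–Schwarz and puts `1/Δ` in front. -/
lemma IsInteraction.gap_le_sq_div [IsProbabilityMeasure P] (hB : B.IsInteraction P T)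
    (hS : B.StandingAssumptions P T S m k) (hΔ : 0 < Δ) (hgap : B.MinGap T Δ) {t : ℕ}
    (ht1 : 1 ≤ t) (ht : t ≤ T) (ω : Ω) : B.gap t ω ≤ B.gap t ω ^ 2 / Δ := by
  rcases (hB.gap_nonneg hS ht1 ht ω).eq_or_lt with h | h
  · rw [← h]
    simp
  · have h1 := hgap t ht1 ht ω _ (hB.mem_A t ht1 ht ω) (sub_pos.1 h)
    have h2 : Δ ≤ B.gap t ω := h1
    rw [le_div_iff₀ hΔ]
    nlinarith

end Gap

/-- The rounds whose window contains a parameter change. -/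
def unstable (B : Run d Ω) (T D : ℕ) : Finset ℕ :=
  open Classical in
  {t ∈ Finset.Icc 1 T | ¬ ∀ s, 1 ≤ s → s ≤ t - 1 → t - 1 - s ≤ D → B.θ s = B.θ t}

/-- If the window of `t` reaches a round with another parameter, some change time `τ` lies in it,
and then `τ ≤ t ≤ τ + D`. Each change thus spoils at most `D + 1` rounds. -/
lemma card_unstable_le (B : Run d Ω) (T D : ℕ) :
    (B.unstable T D).card ≤ B.numChanges T * (D + 1) := by
  classical
  have hfin : {t : ℕ | 2 ≤ t ∧ t ≤ T ∧ B.θ t ≠ B.θ (t - 1)}.Finite :=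
    (Set.finite_Icc 0 T).subset fun t ht => ⟨Nat.zero_le _, ht.2.1⟩
  have hsub : B.unstable T D ⊆ hfin.toFinset.biUnion fun τ => Finset.Icc τ (τ + D) := by
    intro t ht
    simp only [unstable, Finset.mem_filter, Finset.mem_Icc, not_forall] at ht
    obtain ⟨⟨ht1, ht2⟩, s, hs1, hs2, hs3, hne⟩ := ht
    have hex : ∃ τ, s < τ ∧ τ ≤ t ∧ B.θ τ ≠ B.θ (τ - 1) := by
      by_contra! hcon
      have h : ∀ n, s + n ≤ t → B.θ (s + n) = B.θ s := by
        intro n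
        induction n with
        | zero => intro _; rfl
        | succ n ih =>
          intro hn
          rw [hcon (s + (n + 1)) (by omega) hn]
          exact ih (by omega)
      refine hne ?_
      have := h (t - s) (by omega)
      rw [show s + (t - s) = t by omega] at this
      exact this.symm
    obtain ⟨τ, h1, h2, h3⟩ := hex
    simp only [Finset.mem_biUnion, Set.Finite.mem_toFinset, Set.mem_ofPred_eq, Finset.mem_Icc]
    exact ⟨τ, ⟨by omega, by omega, h3⟩, h2, by omega⟩
  refine (Finset.card_le_card hsub).trans ?_
  rw [numChanges, Set.ncard_eq_toFinset_card _ hfin]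
  refine Finset.card_biUnion_le_card_mul _ _ _ fun τ _ => ?_
  rw [Nat.card_Icc]
  omega

/-- Bernoulli's inequality `1 + K y ≤ (1 + y) ^ K`. It moves `c_μ` or `k` out of a logarithm into a
constant factor. -/
lemma log_one_add_mul_le {c K y : ℝ} (hc : 0 ≤ c) (hcK : c ≤ K) (hK : 1 ≤ K) (hy : 0 ≤ y) :
    Real.log (1 + c * y) ≤ K * Real.log (1 + y) := by
  rw [← Real.log_rpow (by linarith)]
  have h1 := one_add_mul_self_le_rpow_one_add (show -1 ≤ y by linarith) hK
  have h2 : c * y ≤ K * y := by gcongr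
  exact Real.log_le_log (by positivity) (by linarith)

lemma logFactor_nonneg (hd : 1 ≤ d) (hlam : 0 < lam) (h0 : 0 < γ) (h1 : γ < 1) :
    0 ≤ logFactor d T lam γ := by
  have hd0 : (0 : ℝ) < d := by exact_mod_cast hd
  have hγ : 0 < 1 - γ := by linarith
  have h2 : 0 ≤ Real.log (1 / γ) := Real.log_nonneg ((one_le_div h0).2 h1.le)
  have h3 : 0 ≤ Real.log (1 + 1 / (d * lam * (1 - γ))) :=
    Real.log_nonneg (le_add_of_nonneg_right (by positivity))
  unfold logFactor
  positivity

/-- Deterministic regret bound on the favourable event. -/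
lemma IsInteraction.regret_le [IsProbabilityMeasure P] (hB : B.IsInteraction P T)
    (hS : B.StandingAssumptions P T S m k) (hd : 1 ≤ d) (hT : 1 ≤ T) (hm : 0 < m) (hlam : 0 < lam)
    (h0 : 0 < γ) (h1 : γ < 1) (hδ : 0 < δ) (hδ1 : δ ≤ 1) (hΔ : 0 < Δ) (hgap : B.MinGap T Δ)
    (halg : B.IsDGLUCB T S m k lam γ δ) (hw0 : ∀ j, 0 ≤ w j) (hw : ∀ j, w j ≤ γ ^ j)
    (hwD : ∀ j, D < j → w j = 0)
    (hwb : ∀ n, ∑ j ∈ Finset.range n, (γ ^ j - w j) ≤ 1 / (T * (1 - γ)))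
    {ω : Ω} (hω : B.Favourable T m lam (rho d T m k lam γ δ) w ω) {b : ℝ} (hb0 : 0 ≤ b)
    (hb : ∀ t, 1 ≤ t → t ≤ T → B.gap t ω ≤ b) :
    B.regret T ω ≤ b * (B.numChanges T * (D + 1))
      + 8 * max 1 (k / lam) * max 1 (k : ℝ)
        * (d * beta d T S m k lam γ δ ^ 2 / (B.cμ S * Δ)) * logFactor d T lam γ := by
  classical
  have hd0 : (0 : ℝ) < d := by exact_mod_cast hd
  have hc : 0 < B.cμ S := hS.cMu_pos
  have hck := hS.cμ_le_lipschitz hT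
  have hγ : 0 < 1 - γ := by linarith
  set β := beta d T S m k lam γ δ with hβ
  have hstab : ∀ t ∈ Finset.Icc 1 T, t ∉ B.unstable T D →
      B.gap t ω ≤ 4 * β ^ 2 / (B.cμ S * Δ)
        * quadForm (B.designMatrix S lam γ t ω)⁻¹ (B.a t ω) := fun t ht htu => by
    have hwin : ∀ s, 1 ≤ s → s ≤ t - 1 → t - 1 - s ≤ D → B.θ s = B.θ t := by
      by_contra hcon
      refine htu ?_
      simp only [unstable, Finset.mem_filter]
      exact ⟨ht, hcon⟩
    rw [Finset.mem_Icc] at ht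
    obtain ⟨θhat, hmin, hmax⟩ := halg t ht.1 ht.2 ω
    have hpred := fun x => abs_le.1 (hB.abs_mean_sub_le hS hT hm hlam h0 h1 hδ hδ1 hw0 hw hwD hwb hω
      ht.1 ht.2 hwin hmin x)
    obtain ⟨x, hx, hxbest⟩ := hB.exists_bestMean_eq hΔ hgap ht.1 ht.2 ω
    have h2 := hmax x hx
    have h3 := (hpred x).1
    have h4 := (hpred (B.a t ω)).2
    unfold index at h2
    -- Optimism: the best action's mean is below its index, hence below the index of the chosen
    -- action, which exceeds that action's mean by at most two bonuses.
    have hle : B.gap t ω ≤ 2 * (β / Real.sqrt (B.cμ S)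
        * matNorm (B.designMatrix S lam γ t ω)⁻¹ (B.a t ω)) := by
      unfold gap
      linarith
    have hVpd : (B.designMatrix S lam γ t ω).PosDef :=
      gram_posDef _ (fun s _ => by positivity) (by positivity)
    have hq := quadForm_nonneg hVpd.inv (B.a t ω)
    have hg0 := hB.gap_nonneg hS ht.1 ht.2 ω
    calc B.gap t ω ≤ B.gap t ω ^ 2 / Δ := hB.gap_le_sq_div hS hΔ hgap ht.1 ht.2 ω
      _ ≤ (2 * (β / Real.sqrt (B.cμ S)
          * matNorm (B.designMatrix S lam γ t ω)⁻¹ (B.a t ω))) ^ 2 / Δ := by gcongr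
      _ = _ := by
          rw [mul_pow, mul_pow, div_pow, Real.sq_sqrt hc.le, matNorm_eq_sqrt, Real.sq_sqrt hq]
          field_simp
          ring
  have hpos : ∀ t ∈ Finset.Icc 1 T, 0 ≤ 4 * β ^ 2 / (B.cμ S * Δ)
      * quadForm (B.designMatrix S lam γ t ω)⁻¹ (B.a t ω) := fun t _ => by
    have hVpd : (B.designMatrix S lam γ t ω).PosDef :=
      gram_posDef _ (fun s _ => by positivity) (by positivity)
    have := quadForm_nonneg hVpd.inv (B.a t ω)
    positivity
  have hsplit : B.regret T ω ≤ ∑ t ∈ Finset.Icc 1 T, ((if t ∈ B.unstable T D then b else 0)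
      + 4 * β ^ 2 / (B.cμ S * Δ)
        * quadForm (B.designMatrix S lam γ t ω)⁻¹ (B.a t ω)) := by
    refine Finset.sum_le_sum fun t ht => ?_
    split_ifs with h
    · have h2 := hb t (Finset.mem_Icc.1 ht).1 (Finset.mem_Icc.1 ht).2
      have h3 := hpos t ht
      unfold gap at h2
      linarith
    · rw [zero_add]
      exact hstab t ht h
  have hunst : ∑ t ∈ Finset.Icc 1 T, (if t ∈ B.unstable T D then b else 0)
      ≤ b * (B.numChanges T * (D + 1)) := by
    rw [← Finset.sum_filter, Finset.sum_const, nsmul_eq_mul, mul_comm]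
    refine mul_le_mul_of_nonneg_left ?_ hb0
    have h2 : (Finset.filter (fun t => t ∈ B.unstable T D) (Finset.Icc 1 T)).card
        ≤ B.numChanges T * (D + 1) :=
      (Finset.card_le_card fun t ht => (Finset.mem_filter.1 ht).2).trans (B.card_unstable_le T D)
    exact_mod_cast h2
  have hell := sum_quadForm_inv_le h0 h1 (show 0 < lam / B.cμ S by positivity) hd
    (T := T) (a := fun s => B.a s ω) fun s hs1 hs2 => hB.norm_action_le hS hs1 hs2 ω
  have hK : 1 ≤ max 1 (k : ℝ) := le_max_left _ _
  have hlf : T * Real.log (1 / γ) + Real.log (1 + 1 / (d * (lam / B.cμ S) * (1 - γ)))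
      ≤ max 1 (k : ℝ) * logFactor d T lam γ := by
    rw [logFactor, mul_add]
    have h2 : 1 / (d * (lam / B.cμ S) * (1 - γ)) = B.cμ S * (1 / (d * lam * (1 - γ))) := by
      field_simp
    rw [h2]
    refine add_le_add (le_mul_of_one_le_left ?_ hK)
      (log_one_add_mul_le hc.le (hck.trans (le_max_right _ _)) hK (by positivity))
    have : 0 ≤ Real.log (1 / γ) := Real.log_nonneg ((one_le_div h0).2 h1.le)
    positivity
  have hlf0 := logFactor_nonneg (T := T) hd hlam h0 h1
  have hmaxle : max 1 (1 / (lam / B.cμ S)) ≤ max 1 (k / lam) := by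
    rw [one_div_div]
    gcongr
  calc B.regret T ω ≤ _ := hsplit
    _ ≤ b * (B.numChanges T * (D + 1)) + 4 * β ^ 2 / (B.cμ S * Δ)
        * (max 1 (k / lam) * (2 * (d * (max 1 (k : ℝ) * logFactor d T lam γ)))) := by
        rw [Finset.sum_add_distrib, ← Finset.mul_sum]
        refine add_le_add hunst (mul_le_mul_of_nonneg_left ?_ (by positivity))
        calc _ ≤ _ := hell
          _ ≤ max 1 (1 / (lam / B.cμ S))
              * (2 * (d * (max 1 (k : ℝ) * logFactor d T lam γ))) := by gcongr
          _ ≤ _ := by gcongr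
    _ = _ := by ring

end Run

end

end GLBandit

/-! ### Sizes of the constants and the high-probability bound -/

namespace GLBandit

noncomputable section

lemma one_half_le_log {T : ℕ} (hT : 2 ≤ T) : 1 / 2 ≤ Real.log T := by
  have h1 : (2 : ℝ) ≤ T := by exact_mod_cast hT
  have h2 := Real.log_le_log (by norm_num) h1
  linarith [Real.log_two_gt_d9]

lemma log_one_add_two_mul_le {T : ℕ} (hT : 2 ≤ T) :
    Real.log (1 + 2 * T) ≤ 3 * Real.log T := by
  have h1 : (2 : ℝ) ≤ T := by exact_mod_cast hT
  have h2 : (1 : ℝ) + 2 * T ≤ (T : ℝ) ^ 3 := by nlinarith [mul_le_mul h1 h1 (by norm_num) (by linarith)]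
  have h3 := Real.log_le_log (by positivity) h2
  rw [Real.log_pow] at h3
  exact_mod_cast h3

lemma log_le_log_div {T : ℕ} {δ : ℝ} (hT : 1 ≤ T) (hδ : 0 < δ) (hδ1 : δ ≤ 1) :
    Real.log T ≤ Real.log (T / δ) := by
  have h1 : (0 : ℝ) < T := by exact_mod_cast hT
  exact Real.log_le_log h1 (by rw [le_div_iff₀ hδ]; nlinarith)

lemma barS_nonneg {T : ℕ} {S m k lam γ : ℝ} (hS : 0 ≤ S) (hm : 0 < m) (hk : 0 ≤ k)
    (hlam : 0 < lam) (h1 : γ < 1) : 0 ≤ barS T S m k lam γ := by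
  have : 0 < 1 - γ := by linarith
  unfold barS
  positivity

lemma beta_nonneg {d T : ℕ} {S m lam γ δ : ℝ} {k : ℝ≥0} (hT : 1 ≤ T) (hS : 0 ≤ S) (hm : 0 < m)
    (hlam : 0 < lam) (h0 : 0 < γ) (h1 : γ < 1) (hδ : 0 < δ) (hδ1 : δ ≤ 1) :
    0 ≤ beta d T S m k lam γ δ := by
  have h2 := barS_nonneg (T := T) hS hm k.coe_nonneg hlam h1
  have h3 := Run.rho_nonneg (d := d) (k := k) hT hm hlam h0 h1 hδ hδ1
  unfold beta
  positivity

lemma rpow_three_halves_sq {x : ℝ} (hx : 0 ≤ x) : (x ^ (3 / 2 : ℝ)) ^ 2 = x ^ 3 := by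
  rw [rpow_three_halves hx, mul_pow, Real.sq_sqrt hx]
  ring

/-- The choice `λ = d log T` makes `d / λ ≤ 2`, which cancels the dimension; `T (1 - γ) ≥ 1` keeps
the logarithmic determinant of order `log T`. -/
lemma rho_div_sqrt_le {d T : ℕ} {m lam γ δ : ℝ} {k : ℝ≥0} (hd : 1 ≤ d) (hT : 2 ≤ T)
    (hm : 0 < m) (hlam : lam = d * Real.log T) (h0 : 0 < γ) (h1 : γ < 1) (hδ : 0 < δ)
    (hδ1 : δ ≤ 1) (hg : 1 ≤ T * (1 - γ)) :
    rho d T m k lam γ δ / Real.sqrt lam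
      ≤ (1 / m + 12 * m + 6 * m * max 1 (k : ℝ)) * Real.log (T / δ) := by
  have hd1 : (1 : ℝ) ≤ d := by exact_mod_cast hd
  have hT2 : (2 : ℝ) ≤ T := by exact_mod_cast hT
  have hγ : 0 < 1 - γ := by linarith
  have hlogT := one_half_le_log hT
  have hL := log_le_log_div (show 1 ≤ T by omega) hδ hδ1
  set L := Real.log (T / δ) with hLdef
  have hL2 : 1 / 2 ≤ L := hlogT.trans hL
  have hlam2 : 1 / 2 ≤ lam := by rw [hlam]; nlinarith
  have hlam0 : 0 < lam := by linarith
  have hl : 0 < Real.sqrt lam := Real.sqrt_pos.2 hlam0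
  have hll : Real.sqrt lam * Real.sqrt lam = lam := Real.mul_self_sqrt hlam0.le
  have hdlam : d / lam ≤ 2 := by
    rw [div_le_iff₀ hlam0, hlam]
    nlinarith
  have hlamL : lam ≤ d * L := by rw [hlam]; gcongr
  have hK : 1 ≤ max 1 (k : ℝ) := le_max_left _ _
  have hlog : Real.log (1 + k * (1 - 1 / (T : ℝ) ^ 2) / (d * lam * (1 - γ ^ 2)))
      ≤ max 1 (k : ℝ) * (3 * L) := by
    have h2 : 1 - γ ≤ 1 - γ ^ 2 := by nlinarith
    have h6 : 0 < 1 - γ ^ 2 := by linarith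
    have h3 : 1 / (d * lam * (1 - γ ^ 2)) ≤ 2 * T := by
      rw [div_le_iff₀ (by positivity)]
      have h4 : 1 / 2 ≤ d * lam := by nlinarith
      have h5 : (1 / 2) * (1 - γ) ≤ d * lam * (1 - γ ^ 2) := by gcongr
      nlinarith
    have h4 : k * (1 - 1 / (T : ℝ) ^ 2) / (d * lam * (1 - γ ^ 2)) ≤ k * (2 * T) := by
      rw [mul_div_assoc]
      refine mul_le_mul_of_nonneg_left (le_trans ?_ h3) k.coe_nonneg
      gcongr
      have : 0 ≤ 1 / (T : ℝ) ^ 2 := by positivity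
      linarith
    have h7 : 0 ≤ k * (1 - 1 / (T : ℝ) ^ 2) / (d * lam * (1 - γ ^ 2)) := by
      have h8 : 0 ≤ 1 - 1 / (T : ℝ) ^ 2 := by
        rw [sub_nonneg, div_le_one (by positivity)]
        nlinarith
      positivity
    calc _ ≤ Real.log (1 + k * (2 * T)) := Real.log_le_log (by positivity) (by linarith)
      _ ≤ max 1 (k : ℝ) * Real.log (1 + 2 * T) :=
          Run.log_one_add_mul_le k.coe_nonneg (le_max_right _ _) hK (by positivity)
      _ ≤ max 1 (k : ℝ) * (3 * L) := by
          gcongr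
          linarith [log_one_add_two_mul_le hT]
  have hsplit : rho d T m k lam γ δ / Real.sqrt lam
      = 1 / (2 * m) + 2 * m * L * (1 / lam) + 2 * m * Real.log 2 * (d / lam)
        + m * Real.log (1 + k * (1 - 1 / (T : ℝ) ^ 2) / (d * lam * (1 - γ ^ 2)))
            * (d / lam) := by
    rw [rho, ← hLdef]
    generalize Real.log (1 + k * (1 - 1 / (T : ℝ) ^ 2) / (d * lam * (1 - γ ^ 2))) = X
    have h2 : Real.sqrt lam * (Real.sqrt lam)⁻¹ = 1 := mul_inv_cancel₀ hl.ne'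
    have h3 : lam⁻¹ = (Real.sqrt lam)⁻¹ * (Real.sqrt lam)⁻¹ := by rw [← mul_inv, hll]
    simp only [div_eq_mul_inv, h3]
    linear_combination (2 * m)⁻¹ * h2
  have h2 : 1 / lam ≤ 2 := by
    rw [div_le_iff₀ hlam0]
    linarith
  have h3 : Real.log 2 ≤ 1 := by linarith [Real.log_two_lt_d9]
  rw [hsplit]
  calc _ ≤ 1 / (2 * m) + 2 * m * L * 2 + 2 * m * 1 * 2 + m * (max 1 (k : ℝ) * (3 * L)) * 2 := by
        gcongr
    _ ≤ 1 / (2 * m) * (2 * L) + 2 * m * L * 2 + 2 * m * 1 * 2 * (2 * L)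
        + m * (max 1 (k : ℝ) * (3 * L)) * 2 := by
        have h4 : 1 ≤ 2 * L := by linarith
        have h5 : 1 / (2 * m) ≤ 1 / (2 * m) * (2 * L) :=
          le_mul_of_one_le_right (by positivity) h4
        have h6 : 2 * m * 1 * 2 ≤ 2 * m * 1 * 2 * (2 * L) :=
          le_mul_of_one_le_right (by positivity) h4
        linarith
    _ = _ := by
        field_simp
        ring

/-- With regularization of order `d log T`, the confidence width is of order `√d` up to
logarithms, provided the discount factor is not too close to one. -/
lemma beta_sq_le {d T : ℕ} {S m lam γ δ : ℝ} {k : ℝ≥0} (hd : 1 ≤ d) (hT : 2 ≤ T) (hS : 0 ≤ S)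
    (hm : 0 < m) (hlam : lam = d * Real.log T) (h0 : 0 < γ) (h1 : γ < 1) (hδ : 0 < δ)
    (hδ1 : δ ≤ 1) (hg : 1 ≤ T * (1 - γ)) :
    beta d T S m k lam γ δ ^ 2 ≤ (k : ℝ) ^ 2
      * (2 * (4 * (1 + S + 2 * (2 * S * k + m))
          + (1 / m + 12 * m + 6 * m * max 1 (k : ℝ)) ^ 2)) ^ 3 * d * Real.log (T / δ) ^ 7 := by
  have hd1 : (1 : ℝ) ≤ d := by exact_mod_cast hd
  have hT2 : (2 : ℝ) ≤ T := by exact_mod_cast hT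
  have hγ : 0 < 1 - γ := by linarith
  have hlogT := one_half_le_log hT
  have hL := log_le_log_div (show 1 ≤ T by omega) hδ hδ1
  set L := Real.log (T / δ) with hLdef
  have hL2 : 1 / 2 ≤ L := hlogT.trans hL
  have hlam2 : 1 / 2 ≤ lam := by rw [hlam]; nlinarith
  have hlam0 : 0 < lam := by linarith
  have hl : 0 < Real.sqrt lam := Real.sqrt_pos.2 hlam0
  have hll : Real.sqrt lam * Real.sqrt lam = lam := Real.mul_self_sqrt hlam0.le
  have hdlam : d / lam ≤ 2 := by
    rw [div_le_iff₀ hlam0, hlam]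
    nlinarith
  have hlamL : lam ≤ d * L := by rw [hlam]; gcongr
  have hK : 1 ≤ max 1 (k : ℝ) := le_max_left _ _
  have hσ : barS T S m k lam γ ≤ S + 2 * (2 * S * k + m) := by
    unfold barS
    have h2 : 1 / 2 ≤ T * lam * (1 - γ) := by nlinarith
    have h3 : (2 * S * k + m) / (T * lam * (1 - γ)) ≤ (2 * S * k + m) / (1 / 2) := by gcongr
    linarith
  have hσ0 := barS_nonneg (T := T) hS hm k.coe_nonneg hlam0 h1
  set σ := barS T S m k lam γ with hσdef
  have hρ0 := Run.rho_nonneg (d := d) (k := k) (show 1 ≤ T by omega) hm hlam0 h0 h1 hδ hδ1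
  have hb := rho_div_sqrt_le (k := k) hd hT hm hlam h0 h1 hδ hδ1 hg
  rw [← hLdef] at hb
  set b := rho d T m k lam γ δ / Real.sqrt lam with hbdef
  have hb0 : 0 ≤ b := by positivity
  set cb := 1 / m + 12 * m + 6 * m * max 1 (k : ℝ) with hcb
  set σ₁ := 1 + S + 2 * (2 * S * k + m) with hσ₁
  have hσ₁0 : 0 ≤ σ₁ := by positivity
  set W := 1 + σ + Real.sqrt ((1 + σ) / lam) * rho d T m k lam γ δ + b ^ 2 with hW
  have hW0 : 0 ≤ W := by positivity
  -- Once cubed this gives `L ^ 6`, and `λ ≤ d L` supplies the seventh power. Only `L ≥ 1/2` is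
  -- available, so constants are padded by `1 ≤ 4 L²`.
  have hWle : W ≤ 2 * (4 * σ₁ + cb ^ 2) * L ^ 2 := by
    have h2 : Real.sqrt ((1 + σ) / lam) * rho d T m k lam γ δ = Real.sqrt (1 + σ) * b := by
      rw [Real.sqrt_div (by linarith), hbdef]
      ring
    have h3 : Real.sqrt (1 + σ) ^ 2 = 1 + σ := Real.sq_sqrt (by linarith)
    have h4 : Real.sqrt (1 + σ) * b ≤ 1 + σ + b ^ 2 := by
      nlinarith [sq_nonneg (Real.sqrt (1 + σ) - b), sq_nonneg b]
    have h5 : b ^ 2 ≤ (cb * L) ^ 2 := by gcongr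
    have h6 : 1 + σ ≤ σ₁ := by rw [hσ₁]; linarith
    have h7 : 1 ≤ 4 * L ^ 2 := by nlinarith
    have h8 : σ₁ ≤ σ₁ * (4 * L ^ 2) := le_mul_of_one_le_right hσ₁0 h7
    have h9 : (cb * L) ^ 2 = cb ^ 2 * L ^ 2 := mul_pow _ _ _
    rw [hW, h2]
    linarith
  rw [beta, mul_pow, mul_pow, Real.sq_sqrt hlam0.le, ← hσdef, ← hbdef, ← hW,
    rpow_three_halves_sq hW0]
  calc (k : ℝ) ^ 2 * lam * W ^ 3
      ≤ (k : ℝ) ^ 2 * (d * L) * (2 * (4 * σ₁ + cb ^ 2) * L ^ 2) ^ 3 := by gcongr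
    _ = _ := by ring

namespace Run

variable {d : ℕ} {Ω : Type u} [mΩ : MeasurableSpace Ω] {B : Run d Ω} {P : Measure Ω}
  {T Γ : ℕ} {S m lam γ δ Δ : ℝ} {k : ℝ≥0}

lemma numChanges_eq_zero (B : Run d Ω) (hT : T ≤ 1) : B.numChanges T = 0 := by
  have : {t : ℕ | 2 ≤ t ∧ t ≤ T ∧ B.θ t ≠ B.θ (t - 1)} = ∅ := by
    ext t
    simp only [Set.mem_ofPred_eq, Set.mem_empty_iff_false, iff_false, not_and]
    omega
  rw [numChanges, this, Set.ncard_empty]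

/-- High-probability regret bound of the discounted algorithm. -/
lemma IsInteraction.measure_regret_le [IsProbabilityMeasure P] (hB : B.IsInteraction P T)
    (hS : B.StandingAssumptions P T S m k) (hd : 1 ≤ d) (hT : 1 ≤ T) (hm : 0 < m) (hlam : 0 < lam)
    (h0 : 0 < γ) (h1 : γ < 1) (hδ : 0 < δ) (hδ1 : δ ≤ 1) (hΔ : 0 < Δ) (hgap : B.MinGap T Δ)
    (hΓ : B.numChanges T ≤ Γ) (halg : B.IsDGLUCB T S m k lam γ δ) {b R : ℝ} (hb0 : 0 ≤ b)
    (hb : ∀ ω t, 1 ≤ t → t ≤ T → B.gap t ω ≤ b)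
    (hR : 3 * b * Real.log T * (Γ / (1 - γ)) + 8 * max 1 (k / lam) * max 1 (k : ℝ)
        * (d * beta d T S m k lam γ δ ^ 2 / (B.cμ S * Δ)) * logFactor d T lam γ ≤ R) :
    P {ω | ¬ B.regret T ω ≤ R} ≤ ENNReal.ofReal δ := by
  obtain ⟨D, w, hw0, hw, hwD, hw2, hwb, hD⟩ := exists_window_weights hT h0 h1
  refine (measure_mono fun ω hω => ?_).trans
    (hB.measure_not_favourable_le hS hd hT hm hlam h0 h1 hδ hw0 hw hw2)
  refine fun hfav => hω ((hB.regret_le hS hd hT hm hlam h0 h1 hδ hδ1 hΔ hgap halg hw0 hw hwD hwb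
    hfav hb0 (hb ω)).trans (le_trans (add_le_add ?_ le_rfl) hR))
  have hγ : 0 < 1 - γ := by linarith
  -- For `T = 1` the factor `log T` vanishes, but there are no changes either. For `T ≥ 2` the extra
  -- round in `D + 1` is absorbed since `log T ≥ 1/2`.
  rcases Nat.lt_or_ge T 2 with h | h
  · rw [B.numChanges_eq_zero (by omega), show T = 1 by omega]
    simp
  · have h2 : (B.numChanges T : ℝ) ≤ Γ := by exact_mod_cast hΓ
    have h3 := one_half_le_log h
    have h4 : 1 / 2 ≤ Real.log T / (1 - γ) := by
      rw [le_div_iff₀ hγ]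
      linarith
    have h5 : (D : ℝ) + 1 ≤ 3 * (Real.log T / (1 - γ)) := by linarith
    calc b * (B.numChanges T * (D + 1)) ≤ b * (Γ * (3 * (Real.log T / (1 - γ)))) := by gcongr
      _ = _ := by ring

/-- Weaker than the bound `m` when `Δ < m`, but it brings the factor `1/Δ` of the tuned rate into
the cost of unstable rounds. -/
lemma IsInteraction.gap_le_div [IsProbabilityMeasure P] (hB : B.IsInteraction P T)
    (hS : B.StandingAssumptions P T S m k) (hΔ : 0 < Δ) (hgap : B.MinGap T Δ) (ω : Ω) {t : ℕ}
    (ht1 : 1 ≤ t) (ht : t ≤ T) : B.gap t ω ≤ m ^ 2 / Δ := by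
  refine (hB.gap_le_sq_div hS hΔ hgap ht1 ht ω).trans ?_
  have h1 := hB.gap_nonneg hS ht1 ht ω
  have h2 := hB.gap_le hS ht1 ht ω
  gcongr

lemma IsInteraction.regret_le_horizon [IsProbabilityMeasure P] (hB : B.IsInteraction P T)
    (hS : B.StandingAssumptions P T S m k) (hΔ : 0 < Δ) (hgap : B.MinGap T Δ) (ω : Ω) :
    B.regret T ω ≤ T * (m ^ 2 / Δ) := by
  calc B.regret T ω ≤ ∑ t ∈ Finset.Icc 1 T, m ^ 2 / Δ :=
        Finset.sum_le_sum fun t ht => hB.gap_le_div hS hΔ hgap ω (Finset.mem_Icc.1 ht).1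
          (Finset.mem_Icc.1 ht).2
    _ = _ := by simp

end Run

/-- The instance-independent part of the tuned bound, in terms of `q = √(c Γ T)`. -/
lemma logFactor_le {d T : ℕ} {lam γ q L : ℝ} (hd : 1 ≤ d) (hT : 2 ≤ T)
    (hlam : lam = d * Real.log T) (hγ2 : 1 / 2 < γ) (hγ : 1 - γ = q / (d * T)) (hq : (d : ℝ) ≤ q)
    (hL : Real.log T ≤ L) : logFactor d T lam γ ≤ 7 * L * (q / d) := by
  have hd1 : (1 : ℝ) ≤ d := by exact_mod_cast hd
  have hT2 : (2 : ℝ) ≤ T := by exact_mod_cast hT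
  have hlogT := one_half_le_log hT
  have hq0 : 0 < q := by linarith
  have hqd : 1 ≤ q / d := (one_le_div (by linarith)).2 hq
  have hg : 0 < 1 - γ := by rw [hγ]; positivity
  have h1 : T * Real.log (1 / γ) ≤ 2 * (q / d) := by
    have h2 : Real.log (1 / γ) ≤ 1 / γ - 1 := Real.log_le_sub_one_of_pos (by positivity)
    have h3 : 1 / γ - 1 ≤ 2 * (1 - γ) := by
      rw [sub_le_iff_le_add, div_le_iff₀ (by linarith)]
      nlinarith
    calc T * Real.log (1 / γ) ≤ T * (2 * (q / (d * T))) := by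
          rw [← hγ]
          gcongr
          exact h2.trans h3
      _ = 2 * (q / d) := by field_simp
  have h2 : Real.log (1 + 1 / (d * lam * (1 - γ))) ≤ 3 * L := by
    have h3 : 1 / (d * lam * (1 - γ)) ≤ 2 * T := by
      have h4 : d * lam * (1 - γ) = d * Real.log T * q / T := by
        rw [hlam, hγ]
        field_simp
      rw [h4, one_div_div, div_le_iff₀ (by positivity)]
      have h5 : 1 / 2 ≤ d * Real.log T * q := by
        calc (1 : ℝ) / 2 = 1 * (1 / 2) * 1 := by norm_num
          _ ≤ d * Real.log T * q := by gcongr; linarith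
      nlinarith
    have hlam0 : 0 < lam := by rw [hlam]; positivity
    have h6 := Real.log_le_log (show 0 < 1 + 1 / (d * lam * (1 - γ)) by positivity)
      (add_le_add_right h3 1)
    linarith [log_one_add_two_mul_le hT]
  have h3 : 3 * L ≤ 3 * L * (q / d) := le_mul_of_one_le_right (by linarith) hqd
  have h4 : 2 * (q / d) ≤ 4 * L * (q / d) := by gcongr; linarith
  unfold logFactor
  linarith

end

end GLBandit

/-! ### The tuned rate -/

namespace GLBandit

noncomputable section

/-- The polylogarithmic constant of the confidence width. -/
def widthConst (S m : ℝ) (k : ℝ≥0) : ℝ :=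
  (k : ℝ) ^ 2 * (2 * (4 * (1 + |S| + 2 * (2 * |S| * k + m))
    + (1 / m + 12 * m + 6 * m * max 1 (k : ℝ)) ^ 2)) ^ 3

lemma widthConst_nonneg {S m : ℝ} (hm : 0 < m) (k : ℝ≥0) : 0 ≤ widthConst S m k := by
  unfold widthConst
  positivity

/-- Outside the regime of interest the tuned rate exceeds the horizon. -/
lemma horizon_le_of_degenerate {d T Γ : ℕ} {γ q c κ : ℝ} (hd : 1 ≤ d) (hT : 1 ≤ T) (hΓ : 1 ≤ Γ)
    (hc : 0 < c) (hck : c ≤ κ) (hq : 0 < q) (hqq : q * q = c * Γ * T) (hγ : 1 - γ = q / (d * T))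
    (h : ¬ ((d : ℝ) ≤ q ∧ 1 / 2 < γ)) : (T : ℝ) ≤ max 1 (2 * κ) * (d * q / c) := by
  have hd1 : (1 : ℝ) ≤ d := by exact_mod_cast hd
  have hT0 : (0 : ℝ) < T := by exact_mod_cast hT
  have hΓ1 : (1 : ℝ) ≤ Γ := by exact_mod_cast hΓ
  have hY0 : 0 < d * q / c := by positivity
  rw [not_and_or, not_le, not_lt] at h
  rcases h with h | h
  · have h9 : (T : ℝ) ≤ d * q / c := by
      rw [le_div_iff₀ hc]
      calc T * c ≤ T * c * Γ := le_mul_of_one_le_right (by positivity) hΓ1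
        _ = q * q := by rw [hqq]; ring
        _ ≤ d * q := by gcongr
    exact h9.trans (le_mul_of_one_le_left hY0.le (le_max_left _ _))
  · have h9 : d * T ≤ 2 * q := by
      have h10 : 1 / 2 ≤ q / (d * T) := by linarith
      rw [le_div_iff₀ (by positivity)] at h10
      linarith
    have h11 : (T : ℝ) ≤ 2 * c * (d * q / c) := by
      have h12 : 2 * c * (d * q / c) = d * (2 * q) := by field_simp
      rw [h12]
      calc (T : ℝ) ≤ d * T := le_mul_of_one_le_left hT0.le hd1
        _ ≤ d * (d * T) := le_mul_of_one_le_left (by positivity) hd1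
        _ ≤ _ := by gcongr
    refine h11.trans ?_
    gcongr
    exact le_trans (by linarith) (le_max_right _ _)

namespace Run

variable {d : ℕ} {Ω : Type u} [mΩ : MeasurableSpace Ω] {B : Run d Ω} {P : Measure Ω}
  {T Γ : ℕ} {S m lam γ δ Δ q : ℝ} {k : ℝ≥0}

/-- The tuned rate in the regime of interest, with `q = √(c_μ Γ T)`. -/
lemma IsInteraction.measure_regret_le_tuned [IsProbabilityMeasure P] (hB : B.IsInteraction P T)
    (hS : B.StandingAssumptions P T S m k) (hd : 1 ≤ d) (hT : 2 ≤ T) (hm : 0 < m) (hδ : 0 < δ)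
    (hδ1 : δ ≤ 1) (hΔ : 0 < Δ) (hgap : B.MinGap T Δ) (hΓ : B.numChanges T ≤ Γ)
    (halg : B.IsDGLUCB T S m k lam γ δ) (hlam : lam = d * Real.log T)
    (hγ : 1 - γ = q / (d * T)) (hqq : q * q = B.cμ S * Γ * T) (hdq : (d : ℝ) ≤ q)
    (hγ2 : 1 / 2 < γ) {R : ℝ}
    (hR : (3 * 2 ^ 7 * m ^ 2 + 56 * max 1 (2 * (k : ℝ)) * max 1 (k : ℝ) * widthConst S m k)
      * Real.log (T / δ) ^ 8 * (d * q / B.cμ S / Δ) ≤ R) :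
    P {ω | ¬ B.regret T ω ≤ R} ≤ ENNReal.ofReal δ := by
  have hT1 : 1 ≤ T := by omega
  have hd1 : (1 : ℝ) ≤ d := by exact_mod_cast hd
  have hT2 : (2 : ℝ) ≤ T := by exact_mod_cast hT
  have hc : 0 < B.cμ S := hS.cMu_pos
  have hS0 := hS.radius_nonneg hT1
  have hlogT := one_half_le_log hT
  have hL := log_le_log_div hT1 hδ hδ1
  set c := B.cμ S with hcdef
  set L := Real.log (T / δ) with hLdef
  have hL2 : 1 ≤ 2 * L := by linarith
  have hL0 : 0 < L := by linarith
  have hq0 : 0 < q := by linarith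
  have hγ0 : 0 < γ := by linarith
  have hγ1 : γ < 1 := by
    have : 0 < q / (d * T) := by positivity
    linarith
  have hlam0 : 0 < lam := by rw [hlam]; positivity
  have hTg : 1 ≤ T * (1 - γ) := by
    rw [hγ, show T * (q / (d * T)) = q / d by field_simp]
    exact (one_le_div (by linarith)).2 hdq
  have hlf := logFactor_le hd hT hlam hγ2 hγ hdq hL
  have hβ : beta d T S m k lam γ δ ^ 2 ≤ widthConst S m k * d * L ^ 7 := by
    rw [widthConst, abs_of_nonneg hS0]
    exact beta_sq_le hd hT hS0 hm hlam hγ0 hγ1 hδ hδ1 hTg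
  have hC := widthConst_nonneg (S := S) hm k
  refine hB.measure_regret_le hS hd hT1 hm hlam0 hγ0 hγ1 hδ hδ1 hΔ hgap hΓ halg
    (b := m ^ 2 / Δ) (by positivity) (fun ω t ht1 ht => hB.gap_le_div hS hΔ hgap ω ht1 ht) ?_
  have e1 : 3 * (m ^ 2 / Δ) * Real.log T * (Γ / (1 - γ))
      ≤ 3 * 2 ^ 7 * m ^ 2 * L ^ 8 * (d * q / c / Δ) := by
    -- The two regret terms balance here: `q² = c Γ T` turns the cost of the changes into the rate
    -- `d q / c` of the other term.
    have h9 : Γ / (1 - γ) = d * q / c := by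
      rw [hγ, div_div_eq_mul_div, div_eq_div_iff hq0.ne' hc.ne',
        show d * q * q = d * (q * q) by ring, hqq]
      ring
    have h10 : Real.log T ≤ 2 ^ 7 * L ^ 8 := by
      calc Real.log T ≤ 1 * L := by linarith
        _ ≤ (2 * L) ^ 7 * L := by gcongr; exact one_le_pow₀ hL2
        _ = _ := by ring
    rw [h9]
    calc _ ≤ 3 * (m ^ 2 / Δ) * (2 ^ 7 * L ^ 8) * (d * q / c) := by gcongr
      _ = _ := by ring
  have hkl : max 1 (k / lam) ≤ max 1 (2 * (k : ℝ)) := by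
    refine max_le_max le_rfl ?_
    rw [div_le_iff₀ hlam0]
    have h11 : 1 / 2 ≤ lam := by rw [hlam]; nlinarith
    have := k.coe_nonneg
    nlinarith
  have e2 : 8 * max 1 (k / lam) * max 1 (k : ℝ) * (d * beta d T S m k lam γ δ ^ 2 / (c * Δ))
        * logFactor d T lam γ
      ≤ 56 * max 1 (2 * (k : ℝ)) * max 1 (k : ℝ) * widthConst S m k * L ^ 8 * (d * q / c / Δ) := by
    have hlf0 := logFactor_nonneg (T := T) hd hlam0 hγ0 hγ1
    calc _ ≤ 8 * max 1 (2 * (k : ℝ)) * max 1 (k : ℝ)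
          * (d * (widthConst S m k * d * L ^ 7) / (c * Δ)) * (7 * L * (q / d)) := by gcongr
      _ = _ := by
          field_simp
          ring
  linarith

end Run

end

end GLBandit

theorem mainTheorem2 :
    -- the four-term bound, for every discount factor in `(1/2, 1)`
    (∀ (S m lam : ℝ) (k : ℝ≥0), 0 < m → 0 < lam →
      ∃ C₁ C₂ C₃ C₄ : ℝ, 0 < C₁ ∧ 0 < C₂ ∧ 0 < C₃ ∧ 0 < C₄ ∧
        ∀ (d T Γ : ℕ) (γ δ Δ : ℝ) (Ω : Type u) [MeasurableSpace Ω] (P : Measure Ω)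
          [IsProbabilityMeasure P] (B : GLBandit.Run d Ω),
          1 ≤ d → 1 ≤ T → 1 / 2 < γ → γ < 1 → 0 < δ → δ ≤ 1 → 0 < Δ →
          B.IsInteraction P T →
          B.StandingAssumptions P T S m k →
          B.numChanges T ≤ Γ →
          B.MinGap T Δ →
          B.IsDGLUCB T S m k lam γ δ →
          P {ω | ¬ B.regret T ω ≤
              C₁ * Real.log T * (Γ / (1 - γ))
              + C₂ * (1 / (T * (1 - γ) ^ 2 * Δ))
              + C₃ * (GLBandit.beta d T S m k lam γ δ * Real.sqrt (d * T)
                  / (Real.sqrt (B.cμ S) * Δ)) * Real.sqrt (GLBandit.logFactor d T lam γ)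
              + C₄ * (d * GLBandit.beta d T S m k lam γ δ ^ 2 / (B.cμ S * Δ))
                  * GLBandit.logFactor d T lam γ}
            ≤ ENNReal.ofReal δ) ∧
    -- the rate for the tuned discount factor and regularization
    (∃ p : ℕ, ∀ (S m : ℝ) (k : ℝ≥0), 0 < m →
      ∃ K : ℝ, 0 < K ∧
        ∀ (d T Γ : ℕ) (lam γ δ Δ : ℝ) (Ω : Type u) [MeasurableSpace Ω] (P : Measure Ω)
          [IsProbabilityMeasure P] (B : GLBandit.Run d Ω),
          1 ≤ d → 2 ≤ T → 1 ≤ Γ → 0 < δ → δ ≤ 1 → 0 < Δ →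
          lam = d * Real.log T →
          γ = 1 - Real.sqrt (B.cμ S * Γ) / (d * Real.sqrt T) → 0 < γ →
          B.IsInteraction P T →
          B.StandingAssumptions P T S m k →
          B.numChanges T ≤ Γ →
          B.MinGap T Δ →
          B.IsDGLUCB T S m k lam γ δ →
          P {ω | ¬ B.regret T ω ≤
              K * Real.log (T / δ) ^ p *
                (Δ⁻¹ * (B.cμ S) ^ (-(1 / 2) : ℝ) * d * Real.sqrt (Γ * T))}
            ≤ ENNReal.ofReal δ) := by
  constructor
  · intro S m lam k hm hlam
    -- The second and third constants are arbitrary, their terms being nonnegative. In the last, `8`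
    -- is `4` from the squared doubled bonus times `2` from the potential.
    refine ⟨3 * m, 1, 1, 8 * max 1 (k / lam) * max 1 (k : ℝ), by positivity, one_pos, one_pos,
      by positivity, ?_⟩
    intro d T Γ γ δ Δ Ω _ P _ B hd hT hγ2 hγ1 hδ hδ1 hΔ hB hS hΓ hgap halg
    have hγ0 : 0 < γ := by linarith
    have hγ : 0 < 1 - γ := by linarith
    refine hB.measure_regret_le hS hd hT hm hlam hγ0 hγ1 hδ hδ1 hΔ hgap hΓ halg hm.le
      (fun ω t ht1 ht => hB.gap_le hS ht1 ht ω) ?_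
    have hβ := GLBandit.beta_nonneg (d := d) (k := k) hT (hS.radius_nonneg hT) hm hlam hγ0 hγ1 hδ
      hδ1
    have hT0 : (0 : ℝ) < T := by exact_mod_cast hT
    have h1 : 0 ≤ 1 * (1 / (T * (1 - γ) ^ 2 * Δ)) := by positivity
    have h2 : 0 ≤ 1 * (GLBandit.beta d T S m k lam γ δ * Real.sqrt (d * T)
        / (Real.sqrt (B.cμ S) * Δ)) * Real.sqrt (GLBandit.logFactor d T lam γ) := by positivity
    linarith
  -- The exponent is seven from `β²` plus one from the logarithmic factor.
  · refine ⟨8, fun S m k hm => ?_⟩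
    have hC := GLBandit.widthConst_nonneg (S := S) hm k
    refine ⟨2 ^ 8 * m ^ 2 * max 1 (2 * (k : ℝ)) + (3 * 2 ^ 7 * m ^ 2
      + 56 * max 1 (2 * (k : ℝ)) * max 1 (k : ℝ) * GLBandit.widthConst S m k), by positivity, ?_⟩
    intro d T Γ lam γ δ Δ Ω _ P _ B hd hT hΓ1 hδ hδ1 hΔ hlam hγdef hγ0 hB hS hΓ hgap halg
    have hT1 : 1 ≤ T := by omega
    have hd0 : (0 : ℝ) < d := by exact_mod_cast hd
    have hT0 : (0 : ℝ) < T := by exact_mod_cast hT1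
    have hΓ0 : (0 : ℝ) < Γ := by exact_mod_cast hΓ1
    have hc : 0 < B.cμ S := hS.cMu_pos
    have hck := hS.cμ_le_lipschitz hT1
    set c := B.cμ S with hcdef
    have hsTT : Real.sqrt T * Real.sqrt T = T := Real.mul_self_sqrt hT0.le
    have hsT : 0 < Real.sqrt T := Real.sqrt_pos.2 hT0
    have hL2 : 1 ≤ 2 * Real.log (T / δ) := by
      linarith [GLBandit.one_half_le_log hT, GLBandit.log_le_log_div hT1 hδ hδ1]
    set L := Real.log (T / δ) with hLdef
    have hL0 : 0 < L := by linarith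
    set q := Real.sqrt (c * Γ * T) with hq
    have hq0 : 0 < q := Real.sqrt_pos.2 (by positivity)
    have hqq : q * q = c * Γ * T := Real.mul_self_sqrt (by positivity)
    have hγ : 1 - γ = q / (d * T) := by
      rw [hγdef, sub_sub_cancel, hq, Real.sqrt_mul (by positivity) (T : ℝ),
        div_eq_div_iff (by positivity) (by positivity)]
      linear_combination (-(Real.sqrt (c * Γ) * d)) * hsTT
    have hYeq : Δ⁻¹ * c ^ (-(1 / 2) : ℝ) * d * Real.sqrt (Γ * T) = d * q / c / Δ := by
      have h1 : (Real.sqrt c)⁻¹ = Real.sqrt c / c := by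
        rw [eq_div_iff hc.ne']
        nth_rewrite 2 [← Real.mul_self_sqrt hc.le]
        rw [inv_mul_cancel_left₀ (Real.sqrt_pos.2 hc).ne']
      rw [Real.rpow_neg hc.le, ← Real.sqrt_eq_rpow, hq, mul_assoc c, Real.sqrt_mul hc.le, h1]
      ring
    rw [hYeq]
    have hY0 : 0 < d * q / c := by positivity
    by_cases hcase : (d : ℝ) ≤ q ∧ 1 / 2 < γ
    · refine hB.measure_regret_le_tuned hS hd hT hm hδ hδ1 hΔ hgap hΓ halg hlam hγ hqq hcase.1
        hcase.2 ?_
      refine mul_le_mul_of_nonneg_right (mul_le_mul_of_nonneg_right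
        (le_add_of_nonneg_left ?_) ?_) ?_ <;> positivity
    -- Here the rate dominates the deterministic bound `T m² / Δ`, so the failure event is empty.
    · have hTY := GLBandit.horizon_le_of_degenerate hd hT1 hΓ1 hc hck hq0 hqq hγ hcase
      have h8 : 1 ≤ 2 ^ 8 * L ^ 8 := by
        rw [← mul_pow]
        exact one_le_pow₀ hL2
      have hempty : {ω | ¬ B.regret T ω ≤ (2 ^ 8 * m ^ 2 * max 1 (2 * (k : ℝ)) + (3 * 2 ^ 7 * m ^ 2
          + 56 * max 1 (2 * (k : ℝ)) * max 1 (k : ℝ) * GLBandit.widthConst S m k)) * L ^ 8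
            * (d * q / c / Δ)} = ∅ := by
        ext ω
        simp only [Set.mem_ofPred_eq, Set.mem_empty_iff_false, iff_false, not_not]
        refine (hB.regret_le_horizon hS hΔ hgap ω).trans ?_
        calc T * (m ^ 2 / Δ) ≤ max 1 (2 * (k : ℝ)) * (d * q / c) * (m ^ 2 / Δ) := by gcongr
          _ = m ^ 2 * max 1 (2 * (k : ℝ)) * 1 * (d * q / c / Δ) := by ring
          _ ≤ m ^ 2 * max 1 (2 * (k : ℝ)) * (2 ^ 8 * L ^ 8) * (d * q / c / Δ) := by gcongr
          _ = 2 ^ 8 * m ^ 2 * max 1 (2 * (k : ℝ)) * L ^ 8 * (d * q / c / Δ) := by ring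
          _ ≤ _ := by
            gcongr
            exact le_add_of_nonneg_right (by positivity)
      rw [hempty, measure_empty]
      exact zero_le
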